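/- **Game.** A network with nodes $V=\{s,t\}$, $s\neq t$, has exactly two parallel edges from $s$ to $t$, both with capacity $\nu>0$ and transit time $\tau>0$. There are two players, both with origin $s$, destination $t$ and supply rate $d$, and there is a time horizon $H$, where $\nu<d$ and $\tau<H$. A strategy of player $j$ with temporal information only consists of integrable functions $g_{e,j}:[0,H)\to[0,1]$, one for each edge $e$, with $\sum_e g_{e,j}(\theta)=1$ for all $\theta\in[0,H)$. A strategy profile $(g_1,g_2)$ prescribes the inflow rates $f^+_{e,j}(\theta)=d\,g_{e,j}(\theta)$ for almost every $\theta\in[0,H)$. **Flow dynamics.** A feasible flow over time consists of integrable inflow and outflow rates $f^+_{e,j},f^-_{e,j}:[0,H)\to\mathbb R_{\ge0}$ with $\sum_e f^+_{e,j}=d$ for each player $j$ and the following properties (conditions on rates are understood for almost every time). Write $F^\pm_{e,j}(\theta)=\int_0^\theta f^\pm_{e,j}$, $z_e(\theta)=\sum_jF^+_{e,j}(\theta)-\sum_jF^-_{e,j}(\theta+\tau)$ for $\theta\ge 0$, $z_e(\theta)=0$ for $\theta<0$, and $T_e(\theta)=\theta+z_e(\theta)/\nu+\tau$. 1. $F^+_{e,j}(\theta)\ge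 F^-_{e,j}(\theta+\tau)$ for all $\theta\in[0,H-\tau)$. 2. For $\theta\in[0,H-\tau)$, $\sum_jf^-_{e,j}(\theta+\tau)$ equals $\nu$ if $z_e(\theta)>0$, and equals $\min\{\sum_jf^+_{e,j}(\theta),\nu\}$ otherwise. 3. For $\theta\in[0,H)$ and $\phi=\max T_e^{-1}(\theta)$, $f^-_{e,j}(\theta)=\frac{f^+_{e,j}(\phi)}{\sum_{j'}f^+_{e,j'}(\phi)}\sum_{j'}f^-_{e,j'}(\theta)$ if $\phi\ge 0$ and $\sum_{j'}f^+_{e,j'}(\phi)>0$, and $f^-_{e,j}(\theta)=0$ otherwise. The payoff of player $j$ is $\rho_j=\sum_eF^-_{e,j}(H)$. A strategy profile is a pure Nash equilibrium if no player can increase her payoff by changing only her own strategy. Let $\mathrm{Opt}$ be the value of a maximum flow over time: the maximum amount of flow that can reach $t$ by time $H$ if flow is supplied at $s$ at rate at most $2d$, enters each edge at rate at most $\nu$ and traverses each edge in time $\tau$. **Theorem.** Every strategy profile results in a feasible flow over time, which is unique up to null sets (so payoffs are well defined). The maximum $\mathrm{Opt}$ exists, and to every strategy of her opponent each player has a response strategy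 that yields her a payoff strictly greater than $\mathrm{Opt}/2$. There is no pure Nash equilibrium. -/

import Mathlib

open MeasureTheory Set

/-- The data of an atomic splittable flow over time game with vertices `V`, edges `E` (parallel
edges are allowed) and players `P`. -/
structure FlowGame (V E P : Type*) where
  tail : E → V
  head : E → V
  /-- transit times -/
  transit : E → ℝ
  transit_pos : ∀ e, 0 < transit e
  /-- capacities -/
  capacity : E → ℝ
  capacity_pos : ∀ e, 0 < capacity e
  source : P → V
  target : P → V
  source_ne_target : ∀ j, source j ≠ target j
  /-- every player's origin can reach her destination -/
  reachable : ∀ j, Relation.ReflTransGen (fun u v => ∃ e, tail e = u ∧ head e = v)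
    (source j) (target j)
  /-- supply rates -/
  supply : P → ℝ
  supply_pos : ∀ j, 0 < supply j
  /-- time horizon -/
  horizon : ℝ
  horizon_pos : 0 < horizon

/-- Inflow rates `f⁺` and outflow rates `f⁻`, one pair for every edge and player. Only their
values at times in `[0, H)` matter. -/
structure FlowRates (E P : Type*) where
  inflow : E → P → ℝ → ℝ
  outflow : E → P → ℝ → ℝ

namespace FlowRates

variable {E P : Type*} [Fintype P]

/-- Cumulative inflow `F⁺` of player `j` into `e` up to time `θ`. -/
noncomputable def cumIn (f : FlowRates E P) (e : E) (j : P) (θ : ℝ) : ℝ :=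
  ∫ ϑ in (0 : ℝ)..θ, f.inflow e j ϑ

/-- Cumulative outflow `F⁻` of player `j` out of `e` up to time `θ`. -/
noncomputable def cumOut (f : FlowRates E P) (e : E) (j : P) (θ : ℝ) : ℝ :=
  ∫ ϑ in (0 : ℝ)..θ, f.outflow e j ϑ

/-- Total inflow rate into `e`. -/
def totalIn (f : FlowRates E P) (e : E) (θ : ℝ) : ℝ := ∑ j, f.inflow e j θ

/-- Total outflow rate out of `e`. -/
def totalOut (f : FlowRates E P) (e : E) (θ : ℝ) : ℝ := ∑ j, f.outflow e j θ

end FlowRates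

namespace FlowGame

variable {V E P : Type*} [DecidableEq V] [Fintype E] [Fintype P]

/-- Queue length `z_e(θ)`; before time `0` all queues are empty. -/
noncomputable def queue (G : FlowGame V E P) (f : FlowRates E P) (e : E) (θ : ℝ) : ℝ :=
  if 0 ≤ θ then ∑ j, f.cumIn e j θ - ∑ j, f.cumOut e j (θ + G.transit e) else 0

/-- Exit time `T_e(θ)` of a particle that enters `e` at time `θ`. -/
noncomputable def exitTime (G : FlowGame V E P) (f : FlowRates E P) (e : E) (θ : ℝ) : ℝ :=
  θ + G.queue f e θ / G.capacity e + G.transit e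

/-- The latest time at which a particle leaving `e` at time `θ` can have entered `e`, that is,
`max T_e⁻¹(θ)`. The queue length at `x` is only determined for `x < H - τ_e`; this is no
restriction for `θ < H`, because `T_e(x) ≥ x + τ_e`. -/
noncomputable def entryTime (G : FlowGame V E P) (f : FlowRates E P) (e : E) (θ : ℝ) : ℝ :=
  sSup {x : ℝ | x < G.horizon - G.transit e ∧ G.exitTime f e x = θ}

/-- Feasible flows over time in the deterministic queuing model. Rates are determined up to null
sets, so conditions on rates are required at almost every time. -/
structure IsFeasible (G : FlowGame V E P) (f : FlowRates E P) : Prop where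
  integrable_in : ∀ e j, IntegrableOn (f.inflow e j) (Ico 0 G.horizon)
  integrable_out : ∀ e j, IntegrableOn (f.outflow e j) (Ico 0 G.horizon)
  nonneg_in : ∀ e j, ∀ θ ∈ Ico 0 G.horizon, 0 ≤ f.inflow e j θ
  nonneg_out : ∀ e j, ∀ θ ∈ Ico 0 G.horizon, 0 ≤ f.outflow e j θ
  /-- flow conservation -/
  conservation : ∀ j v, v ≠ G.target j → ∀ᵐ θ, θ ∈ Ico 0 G.horizon →
    ∑ e with G.tail e = v, f.inflow e j θ - ∑ e with G.head e = v, f.outflow e j θ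
      = if v = G.source j then G.supply j else 0
  /-- non-deficit constraints -/
  nonDeficit : ∀ e j, ∀ θ ∈ Ico 0 (G.horizon - G.transit e),
    0 ≤ f.cumIn e j θ - f.cumOut e j (θ + G.transit e)
  /-- edges operate at capacity whenever there is a queue -/
  atCapacity : ∀ e, ∀ᵐ θ, θ ∈ Ico 0 (G.horizon - G.transit e) →
    f.totalOut e (θ + G.transit e)
      = if 0 < G.queue f e θ then G.capacity e else min (f.totalIn e θ) (G.capacity e)
  /-- a player's share of the outflow is her share of the inflow at the time of entrance; no flow
  enters before time `0` -/
  merging : ∀ e j, ∀ᵐ θ, θ ∈ Ico 0 G.horizon →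
    f.outflow e j θ
      = if 0 ≤ G.entryTime f e θ ∧ 0 < f.totalIn e (G.entryTime f e θ) then
          f.inflow e j (G.entryTime f e θ) / f.totalIn e (G.entryTime f e θ) * f.totalOut e θ
        else 0

/-- Player `j`'s payoff: her net amount of flow that has reached her destination by time `H`. -/
noncomputable def payoff (G : FlowGame V E P) (j : P) (f : FlowRates E P) : ℝ :=
  ∑ e with G.head e = G.target j, f.cumOut e j G.horizon
    - ∑ e with G.tail e = G.target j, f.cumIn e j G.horizon

/-- Strategies of player `j` when the only information is the current time `θ ∈ [0, H)`: at every
node other than her destination, `g e θ` is the proportion of her flow sent into `e`. -/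
structure IsTemporalStrategy (G : FlowGame V E P) (j : P) (g : E → ℝ → ℝ) : Prop where
  integrable : ∀ e, IntegrableOn (g e) (Ico 0 G.horizon)
  mem_unit : ∀ e, ∀ θ ∈ Ico 0 G.horizon, g e θ ∈ Icc (0 : ℝ) 1
  sum_eq_one : ∀ v, v ≠ G.target j → ∀ θ ∈ Ico 0 G.horizon, ∑ e with G.tail e = v, g e θ = 1

/-- `f` is a feasible flow over time that results from the strategy profile `g`. -/
structure IsOutcome (G : FlowGame V E P) (g : P → E → ℝ → ℝ) (f : FlowRates E P) : Prop where
  feasible : G.IsFeasible f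
  inflow_eq : ∀ j e, ∀ᵐ θ, θ ∈ Ico 0 G.horizon →
    f.inflow e j θ
      = if G.tail e = G.target j then 0
        else g j e θ * (∑ e' with G.head e' = G.tail e, f.outflow e' j θ
          + if G.tail e = G.source j then G.supply j else 0)

/-- Pure Nash equilibria with temporal information only: no player can increase her payoff by
unilaterally choosing another strategy. -/
def IsNashEquilibrium [DecidableEq P] (G : FlowGame V E P) (g : P → E → ℝ → ℝ) : Prop :=
  (∀ j, G.IsTemporalStrategy j (g j)) ∧
    ∀ j h, G.IsTemporalStrategy j h → ∀ f f', G.IsOutcome g f →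
      G.IsOutcome (Function.update g j h) f' → G.payoff j f' ≤ G.payoff j f

/-- The rate at which flow leaves `e` at time `θ` if it enters at rates `x e` and traverses `e`
in time `τ_e` without waiting. -/
noncomputable def arrival (G : FlowGame V E P) (x : E → ℝ → ℝ) (e : E) (θ : ℝ) : ℝ :=
  if G.transit e ≤ θ then x e (θ - G.transit e) else 0

/-- Flows over time from `s` to `t` in the classical sense of Ford and Fulkerson, on the
capacitated network of `G` with time horizon `H`, where flow is supplied at `s` at rate at
most `D`. -/
structure IsClassicalFlow (G : FlowGame V E P) (s t : V) (D : ℝ) (x : E → ℝ → ℝ) : Prop where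
  integrable : ∀ e, IntegrableOn (x e) (Ico 0 G.horizon)
  capacity : ∀ e, ∀ θ ∈ Ico 0 G.horizon, x e θ ∈ Icc 0 (G.capacity e)
  conservation : ∀ v, v ≠ s → v ≠ t → ∀ᵐ θ, θ ∈ Ico 0 G.horizon →
    ∑ e with G.tail e = v, x e θ = ∑ e with G.head e = v, G.arrival x e θ
  supply : ∀ᵐ θ, θ ∈ Ico 0 G.horizon →
    ∑ e with G.tail e = s, x e θ ≤ ∑ e with G.head e = s, G.arrival x e θ + D

/-- The amount of flow that a classical flow over time sends into `t` by time `H`. -/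
noncomputable def classicalValue (G : FlowGame V E P) (t : V) (x : E → ℝ → ℝ) : ℝ :=
  ∑ e with G.head e = t, (∫ θ in (0 : ℝ)..G.horizon, G.arrival x e θ)
    - ∑ e with G.tail e = t, (∫ θ in (0 : ℝ)..G.horizon, x e θ)

/-- `opt` is the value of a maximum flow over time from `s` to `t` with inflow rate `D`. -/
def IsMaxFlowOverTimeValue (G : FlowGame V E P) (s t : V) (D opt : ℝ) : Prop :=
  IsGreatest {w : ℝ | ∃ x, G.IsClassicalFlow s t D x ∧ G.classicalValue t x = w} opt

end FlowGame

/-! Let K = ν(H - τ) be the most that one edge can deliver by time H. Since ν < d, the supply can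
fill both edges, so Opt = 2K, and the payoffs of any profile sum to at most 2K. Once each player has
a response worth more than K, an equilibrium would give both players more than K, which is absurd.

The response makes the opponent waste flow. By time T = K/d each player has been supplied with K, so
it suffices that a player's entire supply up to some time y > T arrives. Choose an edge e₁ that the
opponent still uses right before T. The player mirrors the opponent, shifting extra flow into e₁
while keeping the inflow into the other edge e₂ at least ν. So e₁ has received K at some time x < T,
and all of this still arrives in time. From then on the player uses only e₂, whereas the opponent
sends more flow into e₁ before T. Both players together have then been supplied with 2K by time T,
of which e₁ holds more than K, so e₂ has received less than K. As e₂ was never short of work,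
everything that enters it up to a time slightly after T arrives (`lt_sum_of_saturated`,
`exists_response`).

Well-definedness rests on one fluid queue. Its length is the net input reflected at zero, which
solves the queue equation (`backlog_eq_integral`), and a comparison argument shows that no other
function does (`IsQueueOn.le`). The merging rule evaluates rates at entry times, although rates are
known only up to null sets. This is harmless because the entry time map pushes the outflow measure
forward to the inflow measure (`map_entry`), which also yields first in, first out
(`integral_share`). -/

/-! ### A single fluid queue: reflection at zero and the queue equation. -/

namespace FluidQueue

open Filter Topology

/-- A measurable rate that is bounded by `C` and vanishes outside of `[0, H)`. -/
structure IsRate (C H : ℝ) (a : ℝ → ℝ) : Prop where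
  measurable : Measurable a
  nonneg : ∀ x, 0 ≤ a x
  le_bound : ∀ x, a x ≤ C
  eq_zero : ∀ x, x ∉ Ico 0 H → a x = 0

/-- Cumulative inflow minus the cumulative service capacity. -/
noncomputable def netInput (a : ℝ → ℝ) (ν θ : ℝ) : ℝ := (∫ u in (0 : ℝ)..θ, a u) - ν * θ

/-- The amount of service capacity left unused up to time `θ`. -/
noncomputable def idle (a : ℝ → ℝ) (ν θ : ℝ) : ℝ := sSup ((fun u => -netInput a ν u) '' Iic θ)

/-- The queue length at time `θ` of a queue with inflow rate `a` and capacity `ν`. -/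
noncomputable def backlog (a : ℝ → ℝ) (ν θ : ℝ) : ℝ := netInput a ν θ + idle a ν θ

/-- The rate at which the queue is served. -/
noncomputable def service (a : ℝ → ℝ) (ν θ : ℝ) : ℝ :=
  if 0 < backlog a ν θ then ν else min (a θ) ν

/-- The exit time of a particle that enters at time `x`. -/
noncomputable def exit (a : ℝ → ℝ) (ν τ x : ℝ) : ℝ := x + backlog a ν x / ν + τ

/-- The latest entry time of particles that exit at time `θ`. -/
noncomputable def entry (a : ℝ → ℝ) (ν τ θ : ℝ) : ℝ := sSup {x | exit a ν τ x = θ}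

section
variable {C H ν τ : ℝ} {a : ℝ → ℝ}

namespace IsRate

theorem integrable (ha : IsRate C H a) : Integrable a := by
  have hs : Function.support a ⊆ Ico 0 H := fun x hx => by
    by_contra h
    exact hx (ha.eq_zero x h)
  rw [← integrableOn_iff_integrable_of_support_subset hs]
  refine Measure.integrableOn_of_bounded (M := C) (by simp) ha.measurable.aestronglyMeasurable ?_
  refine Eventually.of_forall fun x => ?_
  rw [Real.norm_of_nonneg (ha.nonneg x)]
  exact ha.le_bound x

theorem bound_nonneg (ha : IsRate C H a) : 0 ≤ C := (ha.nonneg 0).trans (ha.le_bound 0)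

theorem integral_sub (ha : IsRate C H a) (x y : ℝ) :
    (∫ u in (0 : ℝ)..y, a u) - ∫ u in (0 : ℝ)..x, a u = ∫ u in x..y, a u :=
  intervalIntegral.integral_interval_sub_left ha.integrable.intervalIntegrable
    ha.integrable.intervalIntegrable

theorem integral_nonneg (ha : IsRate C H a) {x y : ℝ} (h : x ≤ y) : 0 ≤ ∫ u in x..y, a u :=
  intervalIntegral.integral_nonneg h fun u _ => ha.nonneg u

theorem integral_le (ha : IsRate C H a) {x y : ℝ} (h : x ≤ y) :
    ∫ u in x..y, a u ≤ C * (y - x) := by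
  have := intervalIntegral.integral_mono_on (μ := volume) h ha.integrable.intervalIntegrable
    (intervalIntegrable_const (c := C)) fun u _ => ha.le_bound u
  simpa [mul_comm] using this

theorem integral_eq_zero (ha : IsRate C H a) {x : ℝ} (hx : x ≤ 0) : ∫ u in (0 : ℝ)..x, a u = 0 := by
  rw [intervalIntegral.integral_symm, neg_eq_zero, intervalIntegral.integral_of_le hx,
    integral_Ioc_eq_integral_Ioo]
  refine setIntegral_eq_zero_of_forall_eq_zero fun u hu => ha.eq_zero u fun h => ?_
  exact absurd hu.2 (not_lt.2 h.1)

theorem continuous_integral (ha : IsRate C H a) : Continuous fun x => ∫ u in (0 : ℝ)..x, a u :=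
  intervalIntegral.continuous_primitive (fun _ _ => ha.integrable.intervalIntegrable) 0

theorem integral_mono (ha : IsRate C H a) : Monotone fun x => ∫ u in (0 : ℝ)..x, a u := by
  intro x y h
  have := ha.integral_sub x y
  have := ha.integral_nonneg h
  simp only
  linarith

theorem netInput_sub (ha : IsRate C H a) (x y : ℝ) :
    netInput a ν y - netInput a ν x = (∫ u in x..y, a u) - ν * (y - x) := by
  rw [netInput, netInput, ← ha.integral_sub x y]
  ring

theorem continuous_netInput (ha : IsRate C H a) : Continuous (netInput a ν) :=
  ha.continuous_integral.sub (continuous_const.mul continuous_id)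

theorem neg_netInput_le (ha : IsRate C H a) (x : ℝ) : -netInput a ν x ≤ ν * x := by
  have : 0 ≤ ∫ u in (0 : ℝ)..x, a u := by
    rcases le_total 0 x with h | h
    · exact ha.integral_nonneg h
    · exact (ha.integral_eq_zero h).ge
  rw [netInput]
  linarith

theorem bddAbove (ha : IsRate C H a) (hν : 0 < ν) (θ : ℝ) :
    BddAbove ((fun u => -netInput a ν u) '' Iic θ) := by
  refine ⟨ν * θ, ?_⟩
  rintro _ ⟨u, hu, rfl⟩
  exact (ha.neg_netInput_le u).trans (mul_le_mul_of_nonneg_left hu hν.le)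

theorem le_idle (ha : IsRate C H a) (hν : 0 < ν) {u θ : ℝ} (h : u ≤ θ) :
    -netInput a ν u ≤ idle a ν θ :=
  le_csSup (ha.bddAbove hν θ) ⟨u, h, rfl⟩

theorem idle_le {θ c : ℝ} (h : ∀ u ≤ θ, -netInput a ν u ≤ c) : idle a ν θ ≤ c := by
  refine csSup_le ⟨_, θ, self_mem_Iic, rfl⟩ ?_
  rintro _ ⟨u, hu, rfl⟩
  exact h u hu

theorem idle_mono (ha : IsRate C H a) (hν : 0 < ν) : Monotone (idle a ν) := fun _ _ h =>
  idle_le fun _ hu => ha.le_idle hν (hu.trans h)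

theorem idle_le_add (ha : IsRate C H a) (hν : 0 < ν) {x y : ℝ} (h : x ≤ y) :
    idle a ν y ≤ idle a ν x + ν * (y - x) := by
  refine idle_le fun u hu => ?_
  rcases le_total u x with hux | hux
  · have := ha.le_idle hν hux
    have := mul_nonneg hν.le (sub_nonneg.2 h)
    linarith
  · have h1 := ha.netInput_sub (ν := ν) x u
    have h2 := ha.integral_nonneg hux
    have h3 := ha.le_idle hν (le_refl x)
    have h4 := mul_le_mul_of_nonneg_left (sub_le_sub_right hu x) hν.le
    linarith

theorem backlog_nonneg (ha : IsRate C H a) (hν : 0 < ν) (θ : ℝ) : 0 ≤ backlog a ν θ := by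
  have := ha.le_idle hν (le_refl θ)
  rw [backlog]
  linarith

theorem backlog_of_nonpos (ha : IsRate C H a) (hν : 0 < ν) {θ : ℝ} (h : θ ≤ 0) :
    backlog a ν θ = 0 := by
  refine le_antisymm ?_ (ha.backlog_nonneg hν θ)
  have h1 : idle a ν θ ≤ ν * θ := idle_le fun u hu =>
    (ha.neg_netInput_le u).trans (mul_le_mul_of_nonneg_left hu hν.le)
  rw [backlog, netInput, ha.integral_eq_zero h]
  linarith

theorem backlog_sub_le (ha : IsRate C H a) (hν : 0 < ν) {x y : ℝ} (h : x ≤ y) :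
    backlog a ν y - backlog a ν x ≤ ∫ u in x..y, a u := by
  have h1 := ha.netInput_sub (ν := ν) x y
  have h2 := ha.idle_le_add hν h
  rw [backlog, backlog]
  linarith

theorem le_backlog_sub (ha : IsRate C H a) (hν : 0 < ν) {x y : ℝ} (h : x ≤ y) :
    (∫ u in x..y, a u) - ν * (y - x) ≤ backlog a ν y - backlog a ν x := by
  have h1 := ha.netInput_sub (ν := ν) x y
  have h2 := ha.idle_mono hν h
  rw [backlog, backlog]
  linarith

theorem backlog_lipschitz (ha : IsRate C H a) (hν : 0 < ν) :
    LipschitzWith (C + ν).toNNReal (backlog a ν) := by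
  have hC := ha.bound_nonneg
  have key : ∀ x y, x ≤ y → |backlog a ν y - backlog a ν x| ≤ (C + ν) * (y - x) := by
    intro x y h
    have h1 := ha.backlog_sub_le hν h
    have h2 := ha.le_backlog_sub hν h
    have h3 := ha.integral_le h
    have h4 := ha.integral_nonneg h
    have h5 := mul_nonneg hν.le (sub_nonneg.2 h)
    have h6 := mul_nonneg hC (sub_nonneg.2 h)
    rw [abs_le]
    constructor <;> linarith
  refine LipschitzWith.of_dist_le_mul fun x y => ?_
  rw [Real.coe_toNNReal _ (by positivity), Real.dist_eq, Real.dist_eq]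
  rcases le_total x y with h | h
  · rw [abs_sub_comm, abs_sub_comm x, abs_of_nonneg (sub_nonneg.2 h)]
    exact key x y h
  · rw [abs_of_nonneg (sub_nonneg.2 h)]
    exact key y x h

theorem continuous_backlog (ha : IsRate C H a) (hν : 0 < ν) : Continuous (backlog a ν) :=
  (ha.backlog_lipschitz hν).continuous

/-- A running maximum can only increase at a point where it is attained by the current value, and at
such a point the backlog vanishes. -/
theorem idle_eq_of_backlog_pos (ha : IsRate C H a) (hν : 0 < ν) {x y : ℝ} (h : x ≤ y)
    (hpos : ∀ u ∈ Icc x y, 0 < backlog a ν u) : idle a ν y = idle a ν x := by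
  refine le_antisymm ?_ (ha.idle_mono hν h)
  obtain ⟨u, hu, hmax⟩ := isCompact_Icc.exists_isMaxOn (nonempty_Icc.2 h)
    (ha.continuous_netInput (ν := ν)).neg.continuousOn
  rcases le_total (-netInput a ν u) (idle a ν x) with hle | hle
  · refine idle_le fun v hv => ?_
    rcases le_total v x with hvx | hvx
    · exact ha.le_idle hν hvx
    · exact (hmax ⟨hvx, hv⟩).trans hle
  · exfalso
    have : idle a ν u ≤ -netInput a ν u := idle_le fun v hv => by
      rcases le_total v x with hvx | hvx
      · exact (ha.le_idle hν hvx).trans hle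
      · exact hmax ⟨hvx, hv.trans hu.2⟩
    have := hpos u hu
    rw [backlog] at this
    linarith

theorem service_nonneg (ha : IsRate C H a) (hν : 0 < ν) (θ : ℝ) : 0 ≤ service a ν θ := by
  rw [service]
  split_ifs
  · exact hν.le
  · exact le_min (ha.nonneg θ) hν.le

theorem service_of_neg (ha : IsRate C H a) (hν : 0 < ν) {θ : ℝ} (h : θ < 0) :
    service a ν θ = 0 := by
  rw [service, ha.backlog_of_nonpos hν h.le, if_neg (lt_irrefl _),
    ha.eq_zero θ fun h' => absurd h (not_lt.2 h'.1), min_eq_left hν.le]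

end IsRate

theorem service_le (θ : ℝ) : service a ν θ ≤ ν := by
  rw [service]
  split_ifs
  · exact le_rfl
  · exact min_le_right _ _

namespace IsRate

theorem measurable_service (ha : IsRate C H a) (hν : 0 < ν) : Measurable (service a ν) :=
  Measurable.ite (measurableSet_lt measurable_const (ha.continuous_backlog hν).measurable)
    measurable_const (ha.measurable.min measurable_const)

theorem intervalIntegrable_service (ha : IsRate C H a) (hν : 0 < ν) (x y : ℝ) :
    IntervalIntegrable (service a ν) volume x y := by
  refine (intervalIntegrable_const (c := ν)).mono_fun
    (ha.measurable_service hν).aestronglyMeasurable (Eventually.of_forall fun u => ?_)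
  simp only [Real.norm_of_nonneg (ha.service_nonneg hν u), Real.norm_of_nonneg hν.le]
  exact service_le u

/-- At almost every point the Lipschitz function `backlog` is differentiable. Where it is zero it
has a minimum, hence derivative 0; where it is positive, `idle` is locally constant and only the net
input changes. -/
theorem ae_hasDerivAt_backlog (ha : IsRate C H a) (hν : 0 < ν) :
    ∀ᵐ x, HasDerivAt (backlog a ν) (a x - service a ν x) x := by
  filter_upwards [(ha.backlog_lipschitz hν).ae_differentiableAt (μ := volume),
    LocallyIntegrable.ae_hasDerivAt_integral ha.integrable.locallyIntegrable] with x hz hA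
  have hX : HasDerivAt (netInput a ν) (a x - ν) x := by
    have := (hA 0).sub ((hasDerivAt_id x).const_mul ν)
    rw [mul_one] at this
    exact this
  rcases (ha.backlog_nonneg hν x).eq_or_lt with h0 | hpos
  · have hmin : IsLocalMin (backlog a ν) x := Eventually.of_forall fun y => by
      rw [← h0]
      exact ha.backlog_nonneg hν y
    have hd : HasDerivAt (backlog a ν) 0 x := by
      have := hz.hasDerivAt
      rwa [hmin.hasDerivAt_eq_zero this] at this
    have hM : HasDerivAt (idle a ν) (0 - (a x - ν)) x := by
      have : idle a ν = backlog a ν - netInput a ν := by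
        ext y
        simp [backlog]
      rw [this]
      exact hd.sub hX
    -- Unused capacity never decreases, so inflow at an empty queue is at most ν here and is served
    -- at once.
    have hle : 0 ≤ 0 - (a x - ν) :=
      hM.hasDerivWithinAt.nonneg_of_monotoneOn (s := univ) (by
        rw [accPt_principal_iff_nhdsWithin, ← compl_eq_univ_sdiff]
        infer_instance) ((ha.idle_mono hν).monotoneOn _)
    have : service a ν x = a x := by
      rw [service, ← h0, if_neg (lt_irrefl _), min_eq_left (by linarith)]
    rw [this, sub_self]
    exact hd
  · have hs : service a ν x = ν := by rw [service, if_pos hpos]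
    rw [hs]
    have hev : ∀ᶠ y in 𝓝 x, 0 < backlog a ν y :=
      (ha.continuous_backlog hν).continuousAt.eventually (lt_mem_nhds hpos)
    obtain ⟨ε, hε, hball⟩ := Metric.eventually_nhds_iff_ball.1 hev
    refine (hX.add_const (idle a ν x)).congr_of_eventuallyEq ?_
    filter_upwards [Metric.ball_mem_nhds x hε] with y hy
    have hsub : ∀ u ∈ uIcc x y, 0 < backlog a ν u := fun u hu => by
      refine hball u ?_
      rw [Metric.mem_ball, Real.dist_eq] at hy ⊢
      exact (abs_sub_left_of_mem_uIcc hu).trans_lt hy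
    have : idle a ν y = idle a ν x := by
      rcases le_total x y with h | h
      · rw [uIcc_of_le h] at hsub
        exact ha.idle_eq_of_backlog_pos hν h hsub
      · rw [uIcc_of_ge h] at hsub
        exact (ha.idle_eq_of_backlog_pos hν h hsub).symm
    simp [backlog, this]

/-- A Lipschitz function is absolutely continuous, hence the integral of its derivative. -/
theorem backlog_eq_integral (ha : IsRate C H a) (hν : 0 < ν) (θ : ℝ) :
    backlog a ν θ = (∫ u in (0 : ℝ)..θ, a u) - ∫ u in (0 : ℝ)..θ, service a ν u := by
  have h1 := ((ha.backlog_lipschitz hν).lipschitzOnWith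
    (s := uIcc 0 θ)).absolutelyContinuousOnInterval.integral_deriv_eq_sub
  rw [ha.backlog_of_nonpos hν le_rfl, sub_zero] at h1
  rw [← h1, ← intervalIntegral.integral_sub ha.integrable.intervalIntegrable
    (ha.intervalIntegrable_service hν _ _)]
  refine intervalIntegral.integral_congr_ae ?_
  filter_upwards [ha.ae_hasDerivAt_backlog hν] with x hx _
  exact hx.deriv

end IsRate
end
end FluidQueue

/-! ### Exit and entry times, transport of measures, and first in, first out. -/

namespace FluidQueue

open Filter Topology

/-- The outflow rate of a queue followed by a delay `τ`. -/
noncomputable def departure (a : ℝ → ℝ) (ν τ θ : ℝ) : ℝ := service a ν (θ - τ)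

/-- The part of the outflow rate that is due to the part `p` of the inflow rate `a`. -/
noncomputable def share (p a : ℝ → ℝ) (ν τ θ : ℝ) : ℝ :=
  p (entry a ν τ θ) / a (entry a ν τ θ) * departure a ν τ θ

theorem integral_Iic_eq {h : ℝ → ℝ} (h0 : ∀ x < 0, h x = 0) (y : ℝ) :
    ∫ x in Iic y, h x = ∫ x in (0 : ℝ)..y, h x := by
  rcases le_or_gt 0 y with hy | hy
  · rw [intervalIntegral.integral_of_le hy, ← integral_Icc_eq_integral_Ioc]
    refine setIntegral_eq_of_subset_of_forall_sdiff_eq_zero measurableSet_Iic Icc_subset_Iic_self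
      fun x hx => h0 x ?_
    by_contra hlt
    exact hx.2 ⟨not_lt.1 hlt, hx.1⟩
  · rw [intervalIntegral.integral_symm, intervalIntegral.integral_of_le hy.le,
      integral_Ioc_eq_integral_Ioo,
      setIntegral_eq_zero_of_forall_eq_zero fun x (hx : x ∈ Iic y) => h0 x (lt_of_le_of_lt hx hy),
      setIntegral_eq_zero_of_forall_eq_zero fun x (hx : x ∈ Ioo y 0) => h0 x hx.2, neg_zero]

theorem lintegral_Iic_eq {h : ℝ → ℝ} (h0 : ∀ x < 0, h x = 0) (hnn : ∀ x, 0 ≤ h x)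
    (hint : ∀ y, IntervalIntegrable h volume 0 y) (y : ℝ) :
    ∫⁻ x in Iic y, ENNReal.ofReal (h x) = ENNReal.ofReal (∫ x in (0 : ℝ)..y, h x) := by
  have hneg : ∫⁻ x in Iio 0, ENNReal.ofReal (h x) = 0 :=
    setLIntegral_eq_zero measurableSet_Iio fun x hx => by simp [h0 x hx]
  rw [← integral_Iic_eq h0, ofReal_integral_eq_lintegral_ofReal _ (Eventually.of_forall hnn)]
  have hIio : IntegrableOn h (Iio 0) :=
    integrableOn_zero.congr_fun (fun x hx => (h0 x hx).symm) measurableSet_Iio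
  rcases le_or_gt 0 y with hy | hy
  · have : Iic y = Iio 0 ∪ Icc 0 y := (Iio_union_Icc_eq_Iic hy).symm
    rw [this]
    exact hIio.union ((intervalIntegrable_iff_integrableOn_Icc_of_le hy).1 (hint y))
  · exact hIio.mono_set fun x hx => lt_of_le_of_lt hx hy

section
variable {C H ν τ : ℝ} {a : ℝ → ℝ}

namespace IsRate

/-- The backlog shrinks at rate at most ν, so waiting times fall at rate at most 1: no overtaking.
-/
theorem exit_mono (ha : IsRate C H a) (hν : 0 < ν) : Monotone (exit a ν τ) := by
  intro x y h
  have h1 := ha.le_backlog_sub hν h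
  have h2 := ha.integral_nonneg h
  have h3 : -(ν * (y - x)) ≤ backlog a ν y - backlog a ν x := by linarith
  have h4 : -(y - x) ≤ (backlog a ν y - backlog a ν x) / ν := by
    rw [le_div_iff₀ hν]
    linarith
  rw [sub_div] at h4
  rw [exit, exit]
  linarith

theorem continuous_exit (ha : IsRate C H a) (hν : 0 < ν) : Continuous (exit a ν τ) :=
  (continuous_id.add ((ha.continuous_backlog hν).div_const ν)).add continuous_const

theorem add_le_exit (ha : IsRate C H a) (hν : 0 < ν) (x : ℝ) : x + τ ≤ exit a ν τ x := by
  have := div_nonneg (ha.backlog_nonneg hν x) hν.le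
  rw [exit]
  linarith

theorem exit_of_nonpos (ha : IsRate C H a) (hν : 0 < ν) {x : ℝ} (h : x ≤ 0) :
    exit a ν τ x = x + τ := by
  rw [exit, ha.backlog_of_nonpos hν h, zero_div, add_zero]

theorem bddAbove_exit_eq (ha : IsRate C H a) (hν : 0 < ν) (θ : ℝ) :
    BddAbove {x | exit a ν τ x = θ} := by
  refine ⟨θ - τ, fun x hx => ?_⟩
  have := ha.add_le_exit (τ := τ) hν x
  rw [mem_ofPred_eq] at hx
  linarith

theorem exit_entry (ha : IsRate C H a) (hν : 0 < ν) (θ : ℝ) :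
    exit a ν τ (entry a ν τ θ) = θ := by
  have hne : {x | exit a ν τ x = θ}.Nonempty := by
    -- At nonpositive times there is no queue and the exit time is explicit, which gives the lower
    -- witness.
    refine mem_range_of_exists_le_of_exists_ge (ha.continuous_exit hν) ⟨min 0 (θ - τ), ?_⟩
      ⟨θ - τ, ?_⟩
    · rw [ha.exit_of_nonpos hν (min_le_left _ _)]
      linarith [min_le_right 0 (θ - τ)]
    · have := ha.add_le_exit (τ := τ) hν (θ - τ)
      linarith
  exact (isClosed_singleton.preimage (ha.continuous_exit hν)).csSup_mem hne
    (ha.bddAbove_exit_eq hν θ)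

/-- Holds because `entry` selects the latest preimage under a monotone map. This Galois connection
turns preimages of rays under `exit` into rays. -/
theorem exit_le_iff (ha : IsRate C H a) (hν : 0 < ν) {x θ : ℝ} :
    exit a ν τ x ≤ θ ↔ x ≤ entry a ν τ θ := by
  constructor
  · intro h
    by_contra! hlt
    have h1 := ha.exit_mono (τ := τ) hν hlt.le
    rw [ha.exit_entry hν] at h1
    exact absurd (le_csSup (ha.bddAbove_exit_eq hν θ) (le_antisymm h h1)) (not_le.2 hlt)
  · intro h
    exact (ha.exit_mono hν h).trans (ha.exit_entry hν θ).le

theorem entry_le (ha : IsRate C H a) (hν : 0 < ν) (θ : ℝ) : entry a ν τ θ ≤ θ - τ := by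
  have := ha.add_le_exit (τ := τ) hν (entry a ν τ θ)
  rw [ha.exit_entry hν] at this
  linarith

theorem entry_le_entry_iff (ha : IsRate C H a) (hν : 0 < ν) {θ θ' : ℝ} :
    entry a ν τ θ ≤ entry a ν τ θ' ↔ θ ≤ θ' := by
  rw [← ha.exit_le_iff hν, ha.exit_entry hν]

theorem measurable_entry (ha : IsRate C H a) (hν : 0 < ν) : Measurable (entry a ν τ) :=
  Monotone.measurable fun _ _ h => (ha.entry_le_entry_iff hν).2 h

/-- While the work present at time x is being cleared, the queue is served at full rate ν, so
exactly the backlog at x is added to what was served before. -/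
theorem integral_service_exit (ha : IsRate C H a) (hν : 0 < ν) (x : ℝ) :
    ∫ u in (0 : ℝ)..exit a ν τ x - τ, service a ν u = ∫ u in (0 : ℝ)..x, a u := by
  have hy : exit a ν τ x - τ = x + backlog a ν x / ν := by
    rw [exit]
    ring
  have hxy : x ≤ x + backlog a ν x / ν :=
    le_add_of_nonneg_right (div_nonneg (ha.backlog_nonneg hν x) hν.le)
  have h1 : ∫ u in x..x + backlog a ν x / ν, service a ν u
      = ∫ u in x..x + backlog a ν x / ν, ν := by
    refine intervalIntegral.integral_congr_uIoo fun u hu => ?_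
    rw [uIoo_of_le hxy] at hu
    have h2 := ha.le_backlog_sub hν hu.1.le
    have h3 := ha.integral_nonneg hu.1.le
    have h4 : ν * (u - x) < backlog a ν x := by
      rw [← lt_div_iff₀' hν]
      linarith [hu.2]
    rw [service, if_pos (by linarith)]
  rw [hy, ← intervalIntegral.integral_add_adjacent_intervals
    (ha.intervalIntegrable_service hν 0 x) (ha.intervalIntegrable_service hν x _), h1,
    intervalIntegral.integral_const, add_sub_cancel_left, smul_eq_mul,
    div_mul_cancel₀ _ hν.ne', ha.backlog_eq_integral hν]
  ring

theorem departure_nonneg (ha : IsRate C H a) (hν : 0 < ν) (θ : ℝ) : 0 ≤ departure a ν τ θ :=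
  ha.service_nonneg hν _

theorem departure_eq_zero (ha : IsRate C H a) (hν : 0 < ν) {θ : ℝ} (h : θ < τ) :
    departure a ν τ θ = 0 :=
  ha.service_of_neg hν (sub_neg.2 h)

theorem measurable_departure (ha : IsRate C H a) (hν : 0 < ν) : Measurable (departure a ν τ) :=
  (ha.measurable_service hν).comp (measurable_id.sub_const τ)

theorem intervalIntegrable_departure (ha : IsRate C H a) (hν : 0 < ν) (x y : ℝ) :
    IntervalIntegrable (departure a ν τ) volume x y := by
  have := (ha.intervalIntegrable_service hν (x - τ) (y - τ)).comp_sub_right τ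
  rwa [sub_add_cancel, sub_add_cancel] at this

theorem integral_departure (ha : IsRate C H a) (hν : 0 < ν) (hτ : 0 < τ) (θ : ℝ) :
    ∫ u in (0 : ℝ)..θ, departure a ν τ u = ∫ u in (0 : ℝ)..θ - τ, service a ν u := by
  have h0 : ∀ x < 0, departure a ν τ x = 0 := fun x hx => ha.departure_eq_zero hν (hx.trans hτ)
  have h1 : ∫ u in (0 : ℝ)..θ, departure a ν τ u = ∫ u in 0 - τ..θ - τ, service a ν u :=
    intervalIntegral.integral_comp_sub_right (fun u => service a ν u) τ
  have h2 : ∫ u in 0 - τ..0, service a ν u = 0 := by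
    rw [intervalIntegral.integral_of_le (by linarith), integral_Ioc_eq_integral_Ioo]
    exact setIntegral_eq_zero_of_forall_eq_zero fun u hu => ha.service_of_neg hν hu.2
  rw [h1, ← intervalIntegral.integral_add_adjacent_intervals
    (ha.intervalIntegrable_service hν (0 - τ) 0) (ha.intervalIntegrable_service hν 0 _), h2,
    zero_add]

/-- Both measures are determined by their values on the rays up to θ, which are the inflow up to
`entry` and the service up to θ - τ. -/
theorem map_exit (ha : IsRate C H a) (hν : 0 < ν) (hτ : 0 < τ) :
    (volume.withDensity fun x => ENNReal.ofReal (a x)).map (exit a ν τ)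
      = volume.withDensity fun θ => ENNReal.ofReal (departure a ν τ θ) := by
  have : IsFiniteMeasure (volume.withDensity fun x => ENNReal.ofReal (a x)) :=
    isFiniteMeasure_withDensity_ofReal ha.integrable.2
  refine Measure.ext_of_Iic _ _ fun θ => ?_
  have hpre : exit a ν τ ⁻¹' Iic θ = Iic (entry a ν τ θ) := by
    ext x
    exact ha.exit_le_iff hν
  rw [Measure.map_apply (ha.continuous_exit hν).measurable measurableSet_Iic, hpre,
    withDensity_apply _ measurableSet_Iic, withDensity_apply _ measurableSet_Iic,
    lintegral_Iic_eq (fun x hx => ha.eq_zero x fun h => absurd hx (not_lt.2 h.1)) ha.nonneg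
      (fun _ => ha.integrable.intervalIntegrable),
    lintegral_Iic_eq (fun x hx => ha.departure_eq_zero hν (hx.trans hτ)) (ha.departure_nonneg hν)
      (fun _ => ha.intervalIntegrable_departure hν _ _),
    ha.integral_departure hν hτ, ← ha.integral_service_exit (τ := τ) hν, ha.exit_entry hν]

/-- If x is not the latest entry time for its exit time, then `exit` takes the same value at some
rational q. These countably many values form a null set for the outflow measure, which has no atoms,
so by `map_exit` the offending x are negligible for the inflow measure. -/
theorem ae_entry_exit (ha : IsRate C H a) (hν : 0 < ν) (hτ : 0 < τ) :
    ∀ᵐ x ∂(volume.withDensity fun x => ENNReal.ofReal (a x)),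
      entry a ν τ (exit a ν τ x) = x := by
  have key : ∀ q : ℚ, ∀ᵐ x ∂(volume.withDensity fun x => ENNReal.ofReal (a x)),
      exit a ν τ x ≠ exit a ν τ q := by
    intro q
    refine ae_of_ae_map (f := exit a ν τ) (p := fun y => y ≠ exit a ν τ q)
      (ha.continuous_exit hν).measurable.aemeasurable ?_
    rw [ha.map_exit hν hτ]
    exact (withDensity_absolutelyContinuous _ _).ae_le (Measure.ae_ne volume _)
  filter_upwards [ae_all_iff.2 key] with x hx
  have hle : x ≤ entry a ν τ (exit a ν τ x) := (ha.exit_le_iff hν).1 le_rfl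
  by_contra hne
  obtain ⟨q, hxq, hq⟩ := exists_rat_btwn (lt_of_le_of_ne hle (Ne.symm hne))
  exact hx q (le_antisymm (ha.exit_mono hν hxq.le) ((ha.exit_le_iff hν).2 hq.le))

theorem map_entry (ha : IsRate C H a) (hν : 0 < ν) (hτ : 0 < τ) :
    (volume.withDensity fun θ => ENNReal.ofReal (departure a ν τ θ)).map (entry a ν τ)
      = volume.withDensity fun x => ENNReal.ofReal (a x) := by
  rw [← ha.map_exit hν hτ, Measure.map_map (ha.measurable_entry hν)
    (ha.continuous_exit hν).measurable]
  exact (Measure.map_congr (ha.ae_entry_exit hν hτ)).trans Measure.map_id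

/-- Properties that hold at almost every time of entrance with positive inflow hold at the entry
times of almost all departures. -/
theorem ae_entry (ha : IsRate C H a) (hν : 0 < ν) (hτ : 0 < τ) {P : ℝ → Prop}
    (hP : ∀ᵐ x, 0 < a x → P x) : ∀ᵐ θ, 0 < departure a ν τ θ → P (entry a ν τ θ) := by
  have h1 : ∀ᵐ x ∂(volume.withDensity fun x => ENNReal.ofReal (a x)), P x := by
    rw [ae_withDensity_iff ha.measurable.ennreal_ofReal]
    simpa using hP
  rw [← ha.map_entry hν hτ] at h1
  have h2 := ae_of_ae_map (ha.measurable_entry hν).aemeasurable h1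
  rw [ae_withDensity_iff (ha.measurable_departure hν).ennreal_ofReal] at h2
  simpa using h2

theorem ae_entry_pos (ha : IsRate C H a) (hν : 0 < ν) (hτ : 0 < τ) :
    ∀ᵐ θ, 0 < departure a ν τ θ → 0 < a (entry a ν τ θ) :=
  ha.ae_entry hν hτ (Eventually.of_forall fun _ h => h)

theorem measurable_share (ha : IsRate C H a) (hν : 0 < ν) {C' : ℝ} {p : ℝ → ℝ}
    (hp : IsRate C' H p) :
    Measurable (share p a ν τ) :=
  ((hp.measurable.comp (ha.measurable_entry hν)).div
    (ha.measurable.comp (ha.measurable_entry hν))).mul (ha.measurable_departure hν)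

theorem share_nonneg (ha : IsRate C H a) (hν : 0 < ν) {p : ℝ → ℝ} (hp : ∀ x, 0 ≤ p x) (θ : ℝ) :
    0 ≤ share p a ν τ θ :=
  mul_nonneg (div_nonneg (hp _) (ha.nonneg _)) (ha.departure_nonneg hν _)

theorem share_le (ha : IsRate C H a) (hν : 0 < ν) {p : ℝ → ℝ} (hpa : ∀ x, p x ≤ a x) (θ : ℝ) :
    share p a ν τ θ ≤ ν := by
  refine (mul_le_of_le_one_left (ha.departure_nonneg hν _) ?_).trans (service_le _)
  exact div_le_one_of_le₀ (hpa _) (ha.nonneg _)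

/-- First in, first out: what has left by time `y` is what has entered by the corresponding entry
time. -/
theorem integral_share (ha : IsRate C H a) (hν : 0 < ν) (hτ : 0 < τ) {C' : ℝ}
    {p : ℝ → ℝ} (hp : IsRate C' H p) (hpa : ∀ x, p x ≤ a x) (y : ℝ) :
    ∫ θ in (0 : ℝ)..y, share p a ν τ θ = ∫ x in (0 : ℝ)..entry a ν τ y, p x := by
  have h0 : ∀ x < 0, share p a ν τ x = 0 := fun x hx => by
    rw [share, ha.departure_eq_zero hν (hx.trans hτ), mul_zero]
  have hp0 : ∀ x < 0, p x = 0 := fun x hx => hp.eq_zero x fun h => absurd hx (not_lt.2 h.1)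
  have hpre : entry a ν τ ⁻¹' Iic (entry a ν τ y) = Iic y := by
    ext θ
    exact ha.entry_le_entry_iff hν
  -- Change of variables along `entry`, applied to the proportion p / a.
  have h1 := setIntegral_map (μ := volume.withDensity fun θ => ENNReal.ofReal (departure a ν τ θ))
    (g := entry a ν τ) (f := fun x => p x / a x) (s := Iic (entry a ν τ y)) measurableSet_Iic
    (hp.measurable.div ha.measurable).aestronglyMeasurable (ha.measurable_entry hν).aemeasurable
  rw [ha.map_entry hν hτ, hpre,
    setIntegral_withDensity_eq_setIntegral_toReal_smul ha.measurable.ennreal_ofReal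
      (Eventually.of_forall fun _ => ENNReal.ofReal_lt_top) _ measurableSet_Iic,
    setIntegral_withDensity_eq_setIntegral_toReal_smul (ha.measurable_departure hν).ennreal_ofReal
      (Eventually.of_forall fun _ => ENNReal.ofReal_lt_top) _ measurableSet_Iic] at h1
  rw [← integral_Iic_eq h0, ← integral_Iic_eq hp0]
  convert h1.symm using 1
  · refine integral_congr_ae (Eventually.of_forall fun θ => ?_)
    simp only [share, ENNReal.toReal_ofReal (ha.departure_nonneg hν _), smul_eq_mul]
    ring
  · refine integral_congr_ae (Eventually.of_forall fun x => ?_)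
    simp only [ENNReal.toReal_ofReal (ha.nonneg _), smul_eq_mul]
    -- Where a vanishes so does p, so the convention for division by zero does no harm.
    rcases (ha.nonneg x).eq_or_lt with h | h
    · rw [← h, zero_mul]
      exact le_antisymm (h ▸ hpa x) (hp.nonneg x)
    · field_simp

end IsRate

/-! ### Uniqueness of the queue length. -/

/-- `ζ` is the length on `[0, L)` of a queue with inflow rate `a`, capacity `ν` and service
rate `β`. -/
structure IsQueueOn (a : ℝ → ℝ) (ν L : ℝ) (ζ β : ℝ → ℝ) : Prop where
  intervalIntegrable : ∀ θ ∈ Ico 0 L, IntervalIntegrable β volume 0 θ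
  eq_integral : ∀ θ ∈ Ico 0 L, ζ θ = (∫ u in (0 : ℝ)..θ, a u) - ∫ u in (0 : ℝ)..θ, β u
  nonneg : ∀ θ ∈ Ico 0 L, 0 ≤ ζ θ
  service : ∀ᵐ θ, θ ∈ Ico 0 L → β θ = if 0 < ζ θ then ν else min (a θ) ν

theorem IsRate.isQueueOn (ha : IsRate C H a) (hν : 0 < ν) (L : ℝ) :
    IsQueueOn a ν L (backlog a ν) (service a ν) where
  intervalIntegrable _ _ := ha.intervalIntegrable_service hν _ _
  eq_integral θ _ := ha.backlog_eq_integral hν θ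
  nonneg θ _ := ha.backlog_nonneg hν θ
  service := Eventually.of_forall fun _ _ => rfl

/-- Suppose ζ exceeds ζ' at θ, and let u be the last time before θ with ζ ≤ ζ'. After u the queue ζ
is positive and thus served at full capacity, so it grows no faster than ζ' and cannot have
overtaken it. -/
theorem IsQueueOn.le (ha : IsRate C H a) {L : ℝ} {ζ ζ' β β' : ℝ → ℝ}
    (h : IsQueueOn a ν L ζ β) (h' : IsQueueOn a ν L ζ' β') {θ : ℝ} (hθ : θ ∈ Ico 0 L) :
    ζ θ ≤ ζ' θ := by
  have hsub : Icc 0 θ ⊆ Ico 0 L := fun u hu => ⟨hu.1, hu.2.trans_lt hθ.2⟩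
  have hcont : ∀ {η γ : ℝ → ℝ}, IsQueueOn a ν L η γ → ContinuousOn η (Icc 0 θ) := by
    intro η γ hη
    have := intervalIntegral.continuousOn_primitive_interval' (hη.intervalIntegrable θ hθ)
      left_mem_uIcc
    rw [uIcc_of_le hθ.1] at this
    exact (ha.continuous_integral.continuousOn.sub this).congr
      fun u hu => hη.eq_integral u (hsub hu)
  by_contra! hlt
  set S := {u ∈ Icc 0 θ | ζ u ≤ ζ' u} with hS
  have hSc : IsClosed S := isClosed_Icc.isClosed_le (hcont h) (hcont h')
  have h0L : (0 : ℝ) ∈ Ico 0 L := hsub (left_mem_Icc.2 hθ.1)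
  have hne : S.Nonempty := ⟨0, left_mem_Icc.2 hθ.1, by
    rw [h.eq_integral 0 h0L, h'.eq_integral 0 h0L]
    simp⟩
  have hbdd : BddAbove S := ⟨θ, fun u hu => hu.1.2⟩
  have hmem := hSc.csSup_mem hne hbdd
  set u := sSup S
  have huθ : u ≤ θ := hmem.1.2
  have hint : ∀ {η γ : ℝ → ℝ}, IsQueueOn a ν L η γ → IntervalIntegrable γ volume u θ :=
    fun hη => (hη.intervalIntegrable u (hsub hmem.1)).symm.trans (hη.intervalIntegrable θ hθ)
  have hinc : ∀ {η γ : ℝ → ℝ}, IsQueueOn a ν L η γ →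
      η θ - η u = (∫ v in u..θ, a v) - ∫ v in u..θ, γ v := by
    intro η γ hη
    rw [hη.eq_integral θ hθ, hη.eq_integral u (hsub hmem.1), ← ha.integral_sub u θ,
      ← intervalIntegral.integral_interval_sub_left (hη.intervalIntegrable θ hθ)
        (hη.intervalIntegrable u (hsub hmem.1))]
    ring
  have hβ : ∫ v in u..θ, β' v ≤ ∫ v in u..θ, β v := by
    refine intervalIntegral.integral_mono_ae_restrict huθ (hint h') (hint h) ?_
    rw [Filter.EventuallyLE, ae_restrict_iff' measurableSet_Icc]
    filter_upwards [h.service, h'.service, Measure.ae_ne volume u] with v hv hv' hvu hvm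
    have hvI : v ∈ Icc 0 θ := ⟨hmem.1.1.trans hvm.1, hvm.2⟩
    have hpos : 0 < ζ v := by
      refine (h'.nonneg v (hsub hvI)).trans_lt ?_
      by_contra! hle
      exact hvu (le_antisymm (le_csSup hbdd ⟨hvI, hle⟩) hvm.1)
    rw [hv (hsub hvI), hv' (hsub hvI), if_pos hpos]
    split_ifs
    · exact le_rfl
    · exact min_le_right _ _
  have h1 := hinc h
  have h2 := hinc h'
  have h3 := hmem.2
  linarith

theorem IsQueueOn.eq_backlog (ha : IsRate C H a) (hν : 0 < ν) {L : ℝ} {ζ β : ℝ → ℝ}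
    (h : IsQueueOn a ν L ζ β) {θ : ℝ} (hθ : θ ∈ Ico 0 L) : ζ θ = backlog a ν θ :=
  le_antisymm (h.le ha (ha.isQueueOn hν L) hθ) ((ha.isQueueOn hν L).le ha h hθ)

end
end FluidQueue

/-! ### Several players sharing one queue. -/

namespace FluidQueue

open Filter Topology

theorem intervalIntegrable_of_mem_Icc {h : ℝ → ℝ} {H x y : ℝ} (hh : IntegrableOn h (Ico 0 H))
    (hx : x ∈ Icc 0 H) (hy : y ∈ Icc 0 H) : IntervalIntegrable h volume x y := by
  have h0 : ∀ z ∈ Icc 0 H, IntervalIntegrable h volume 0 z := fun z hz => by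
    rw [intervalIntegrable_iff_integrableOn_Ico_of_le hz.1]
    exact hh.mono_set (Ico_subset_Ico_right hz.2)
  exact (h0 x hx).symm.trans (h0 y hy)

theorem integral_congr_of_ae_Ico {h k : ℝ → ℝ} {H x y : ℝ}
    (hhk : ∀ᵐ θ, θ ∈ Ico 0 H → h θ = k θ) (hx : x ∈ Icc 0 H) (hy : y ∈ Icc 0 H) :
    ∫ u in x..y, h u = ∫ u in x..y, k u := by
  refine intervalIntegral.integral_congr_ae ?_
  filter_upwards [hhk, Measure.ae_ne volume H] with u hu huH hmem
  refine hu ⟨(le_min hx.1 hy.1).trans hmem.1.le, ?_⟩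
  exact lt_of_le_of_ne (hmem.2.trans (max_le hx.2 hy.2)) huH

/-- The total of the rates of all players. -/
def total {P : Type*} [Fintype P] (α : P → ℝ → ℝ) (θ : ℝ) : ℝ := ∑ j, α j θ

section
variable {P : Type*} [Fintype P] {d H ν τ : ℝ} {α : P → ℝ → ℝ}

theorem isRate_total (hα : ∀ j, IsRate d H (α j)) :
    IsRate (Fintype.card P * d) H (total α) where
  measurable := Finset.measurable_fun_sum _ fun j _ => (hα j).measurable
  nonneg θ := Finset.sum_nonneg fun j _ => (hα j).nonneg θ
  le_bound θ := by
    refine (Finset.sum_le_card_nsmul _ _ d fun j _ => (hα j).le_bound θ).trans_eq ?_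
    rw [nsmul_eq_mul, Finset.card_univ]
  eq_zero θ hθ := Finset.sum_eq_zero fun j _ => (hα j).eq_zero θ hθ

theorem rate_le_total (hα : ∀ j, IsRate d H (α j)) (j : P) (θ : ℝ) : α j θ ≤ total α θ :=
  Finset.single_le_sum (f := fun j => α j θ) (fun j _ => (hα j).nonneg θ) (Finset.mem_univ j)

/-- The proportions sum to 1 wherever the total inflow at the entry time is positive, which is the
case for almost all departures. -/
theorem sum_share (hα : ∀ j, IsRate d H (α j)) (hν : 0 < ν) (hτ : 0 < τ) :
    ∀ᵐ θ, ∑ j, share (α j) (total α) ν τ θ = departure (total α) ν τ θ := by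
  filter_upwards [(isRate_total hα).ae_entry_pos hν hτ] with θ hθ
  simp only [share]
  rw [← Finset.sum_mul, ← Finset.sum_div]
  rcases ((isRate_total hα).departure_nonneg (τ := τ) hν θ).eq_or_lt with h | h
  · rw [← h, mul_zero]
  · have := hθ h
    rw [total] at this
    rw [total, div_self this.ne', one_mul]

end
end FluidQueue

/-! ### Existence and uniqueness of the outcome of a strategy profile. -/

namespace FlowGame

open FluidQueue

/-- A network with two vertices whose edges are parallel, in which edges and players do not
differ. -/
structure IsParallelNetwork {V E P : Type*} (G : FlowGame V E P) (s t : V) (ν τ d : ℝ) :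
    Prop where
  source_ne : s ≠ t
  eq_or_eq : ∀ v, v = s ∨ v = t
  tail : ∀ e, G.tail e = s
  head : ∀ e, G.head e = t
  source : ∀ j, G.source j = s
  target : ∀ j, G.target j = t
  capacity : ∀ e, G.capacity e = ν
  transit : ∀ e, G.transit e = τ
  supply : ∀ j, G.supply j = d
  capacity_pos : 0 < ν
  transit_pos : 0 < τ
  supply_pos : 0 < d
  transit_lt : τ < G.horizon

section
variable {V E P : Type*} [DecidableEq V] [Fintype E] [Fintype P] {G : FlowGame V E P} {s t : V}
  {ν τ d : ℝ} {α : E → P → ℝ → ℝ} {f : FlowRates E P}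

/-- The flow over time with inflow rates `α` on edges of capacity `ν` and transit time `τ`. -/
noncomputable def queueFlow (α : E → P → ℝ → ℝ) (ν τ : ℝ) : FlowRates E P where
  inflow := α
  outflow e j := share (α e j) (total (α e)) ν τ

omit [Fintype E] in
@[simp]
theorem queueFlow_inflow (e : E) (j : P) : (queueFlow α ν τ).inflow e j = α e j := rfl

omit [Fintype E] in
@[simp]
theorem queueFlow_outflow (e : E) (j : P) :
    (queueFlow α ν τ).outflow e j = share (α e j) (total (α e)) ν τ := rfl

/-- Measurable inflow rates for a strategy profile. -/
structure IsInflow (G : FlowGame V E P) (d : ℝ) (g : P → E → ℝ → ℝ) (α : E → P → ℝ → ℝ) :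
    Prop where
  isRate : ∀ e j, IsRate d G.horizon (α e j)
  ae_eq : ∀ e j, ∀ᵐ θ, θ ∈ Ico 0 G.horizon → α e j θ = d * g j e θ

omit [Fintype P] in
theorem exists_isInflow (hd : 0 < d) {g : P → E → ℝ → ℝ}
    (hg : ∀ j, G.IsTemporalStrategy j (g j)) : ∃ α, IsInflow G d g α := by
  have key : ∀ e j, ∃ a : ℝ → ℝ, IsRate d G.horizon a ∧
      ∀ᵐ θ, θ ∈ Ico 0 G.horizon → a θ = d * g j e θ := by
    intro e j
    obtain ⟨h, hm, hh⟩ := ((hg j).integrable e).aestronglyMeasurable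
    -- A measurable representative is clamped to [0, 1] and cut off outside the horizon, so that the
    -- bounds hold everywhere and not just almost everywhere.
    refine ⟨(Ico 0 G.horizon).indicator fun θ => d * max 0 (min 1 (h θ)), ⟨?_, ?_, ?_, ?_⟩, ?_⟩
    · exact (measurable_const.mul (measurable_const.max (measurable_const.min
        hm.measurable))).indicator measurableSet_Ico
    · exact indicator_nonneg fun θ _ => mul_nonneg hd.le (le_max_left _ _)
    · refine indicator_le' (fun θ _ => ?_) fun θ _ => hd.le
      exact mul_le_of_le_one_right hd.le (max_le zero_le_one (min_le_left _ _))
    · exact fun θ hθ => indicator_of_notMem hθ _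
    · rw [Filter.EventuallyEq, ae_restrict_iff' measurableSet_Ico] at hh
      filter_upwards [hh] with θ hθ hmem
      have := (hg j).mem_unit e θ hmem
      rw [indicator_of_mem hmem, ← hθ hmem, min_eq_right this.2, max_eq_right this.1]
  choose α hα using key
  exact ⟨α, fun e j => (hα e j).1, fun e j => (hα e j).2⟩

namespace IsParallelNetwork

section feasible

variable (hG : G.IsParallelNetwork s t ν τ d) (hα : ∀ e j, IsRate d G.horizon (α e j))
include hG hα

omit [DecidableEq V] [Fintype E] in
theorem cumOut_queueFlow (e : E) (j : P) (y : ℝ) :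
    (queueFlow α ν τ).cumOut e j y = ∫ x in (0 : ℝ)..entry (total (α e)) ν τ y, α e j x :=
  (isRate_total (hα e)).integral_share hG.capacity_pos hG.transit_pos (hα e j)
    (rate_le_total (hα e) j) y

omit [DecidableEq V] [Fintype E] in
theorem queue_queueFlow (e : E) (θ : ℝ) :
    G.queue (queueFlow α ν τ) e θ = backlog (total (α e)) ν θ := by
  have ha := isRate_total (hα e)
  have hν := hG.capacity_pos
  rw [queue]
  split_ifs with h
  · have h1 : ∑ j, (queueFlow α ν τ).cumIn e j θ = ∫ u in (0 : ℝ)..θ, total (α e) u :=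
      (intervalIntegral.integral_finsetSum fun j _ =>
        (hα e j).integrable.intervalIntegrable).symm
    have h2 : ∑ j, (queueFlow α ν τ).cumOut e j (θ + G.transit e)
        = ∫ u in (0 : ℝ)..θ, service (total (α e)) ν u := by
      simp_rw [hG.cumOut_queueFlow hα, hG.transit]
      rw [← intervalIntegral.integral_finsetSum fun j _ =>
        (hα e j).integrable.intervalIntegrable]
      have h3 := ha.integral_service_exit (τ := τ) hν (entry (total (α e)) ν τ (θ + τ))
      rw [ha.exit_entry hν, add_sub_cancel_right] at h3
      exact h3.symm
    rw [h1, h2, ha.backlog_eq_integral hν]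
  · rw [ha.backlog_of_nonpos hν (not_le.1 h).le]

omit [DecidableEq V] [Fintype E] in
theorem exitTime_queueFlow (e : E) (θ : ℝ) :
    G.exitTime (queueFlow α ν τ) e θ = exit (total (α e)) ν τ θ := by
  rw [exitTime, exit, hG.queue_queueFlow hα, hG.capacity, hG.transit]

-- The restriction x < H - τ in `entryTime` is automatic when θ < H, because exiting takes at least
-- τ.
omit [DecidableEq V] [Fintype E] in
theorem entryTime_eq_entry {e : E} (h : ∀ x < G.horizon - τ,
    G.exitTime f e x = exit (total (α e)) ν τ x) {θ : ℝ} (hθ : θ < G.horizon) :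
    G.entryTime f e θ = entry (total (α e)) ν τ θ := by
  rw [entryTime, entry]
  congr 1
  ext x
  rw [mem_ofPred_eq, mem_ofPred_eq, hG.transit]
  constructor
  · rintro ⟨hx, hxθ⟩
    rw [← h x hx, hxθ]
  · intro hx
    have := (isRate_total (hα e)).add_le_exit (τ := τ) hG.capacity_pos x
    have hlt : x < G.horizon - τ := by linarith
    exact ⟨hlt, by rw [h x hlt, hx]⟩

omit [DecidableEq V] [Fintype E] in
theorem totalOut_queueFlow (e : E) :
    ∀ᵐ θ, (queueFlow α ν τ).totalOut e θ = departure (total (α e)) ν τ θ :=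
  sum_share (hα e) hG.capacity_pos hG.transit_pos

theorem isFeasible_queueFlow
    (hsum : ∀ j, ∀ᵐ θ, θ ∈ Ico 0 G.horizon → ∑ e, α e j θ = d) :
    G.IsFeasible (queueFlow α ν τ) where
  integrable_in e j := (hα e j).integrable.integrableOn
  integrable_out e j := by
    refine Measure.integrableOn_of_bounded (M := ν) (by simp)
      ((isRate_total (hα e)).measurable_share hG.capacity_pos (hα e j)).aestronglyMeasurable
      (Filter.Eventually.of_forall fun θ => ?_)
    have ha := isRate_total (hα e)
    rw [queueFlow_outflow, Real.norm_of_nonneg (ha.share_nonneg hG.capacity_pos (hα e j).nonneg θ)]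
    exact ha.share_le hG.capacity_pos (rate_le_total (hα e) j) θ
  nonneg_in e j θ _ := (hα e j).nonneg θ
  nonneg_out e j θ _ := (isRate_total (hα e)).share_nonneg hG.capacity_pos (hα e j).nonneg θ
  conservation j v hv := by
    have hvs : v = s := (hG.eq_or_eq v).resolve_right (hG.target j ▸ hv)
    subst hvs
    filter_upwards [hsum j] with θ hθ hmem
    simpa [hG.tail, hG.head, hG.source, hG.source_ne.symm, hG.supply] using hθ hmem
  nonDeficit e j θ _ := by
    rw [hG.cumOut_queueFlow hα, hG.transit, sub_nonneg]
    refine (hα e j).integral_mono ?_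
    simpa using (isRate_total (hα e)).entry_le (τ := τ) hG.capacity_pos (θ + τ)
  atCapacity e := by
    filter_upwards [(eventually_add_right_iff volume τ).2 (hG.totalOut_queueFlow hα e)] with θ hθ _
    rw [hG.transit, hθ, departure, add_sub_cancel_right, hG.queue_queueFlow hα, hG.capacity]
    rfl
  merging e j := by
    filter_upwards [hG.totalOut_queueFlow hα e] with θ hθ hmem
    have ha := isRate_total (hα e)
    rw [hG.entryTime_eq_entry hα (fun x _ => hG.exitTime_queueFlow hα e x) hmem.2, hθ]
    by_cases h : 0 ≤ entry (total (α e)) ν τ θ ∧ 0 < total (α e) (entry (total (α e)) ν τ θ)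
    · exact (if_pos h).symm
    · have h0 : total (α e) (entry (total (α e)) ν τ θ) = 0 := by
        by_contra hne
        have hpos := (ha.nonneg (entry (total (α e)) ν τ θ)).lt_of_ne' hne
        refine h ⟨?_, hpos⟩
        by_contra! hneg
        exact hne (ha.eq_zero _ fun h' => absurd h'.1 (not_le.2 hneg))
      refine Eq.trans ?_ (if_neg h).symm
      rw [queueFlow_outflow, share, h0, div_zero, zero_mul]

end feasible

theorem isOutcome_queueFlow (hG : G.IsParallelNetwork s t ν τ d) {g : P → E → ℝ → ℝ}
    (hg : ∀ j, G.IsTemporalStrategy j (g j)) (hα : IsInflow G d g α) :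
    G.IsOutcome g (queueFlow α ν τ) where
  feasible := by
    refine hG.isFeasible_queueFlow hα.isRate fun j => ?_
    filter_upwards [eventually_countable_forall.2 fun e => hα.ae_eq e j] with θ hθ hmem
    rw [Finset.sum_congr rfl fun e _ => hθ e hmem, ← Finset.mul_sum]
    have := (hg j).sum_eq_one s (by rw [hG.target]; exact hG.source_ne) θ hmem
    simp only [hG.tail, Finset.filter_true] at this
    rw [this, mul_one]
  inflow_eq j e := by
    filter_upwards [hα.ae_eq e j] with θ hθ hmem
    simpa [hG.tail, hG.head, hG.source, hG.target, hG.source_ne, hG.source_ne.symm, hG.supply,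
      mul_comm] using hθ hmem

section outcome

variable (hG : G.IsParallelNetwork s t ν τ d) (hα : ∀ e j, IsRate d G.horizon (α e j))
  (hf : G.IsFeasible f) (hin : ∀ e j, ∀ᵐ θ, θ ∈ Ico 0 G.horizon → f.inflow e j θ = α e j θ)

include hG hf in
theorem queue_nonneg (e : E) {x : ℝ} (hx : x < G.horizon - τ) : 0 ≤ G.queue f e x := by
  rw [queue]
  split_ifs with h
  · rw [← Finset.sum_sub_distrib]
    exact Finset.sum_nonneg fun j _ => hf.nonDeficit e j x ⟨h, by rwa [hG.transit]⟩
  · exact le_rfl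

-- Queues are nonnegative and empty before time 0, so flow leaving at θ < τ would have had to enter
-- at θ - τ < 0. Thus the cumulative outflow in `queue` only counts from time τ on.
include hG hf in
theorem outflow_eq_zero (e : E) (j : P) : ∀ᵐ θ, θ ∈ Ico 0 τ → f.outflow e j θ = 0 := by
  filter_upwards [hf.merging e j] with θ hθ hmem
  have hH := hG.transit_lt
  rw [hθ ⟨hmem.1, hmem.2.trans hH⟩, if_neg]
  have : G.entryTime f e θ = θ - τ := by
    have hset : {x : ℝ | x < G.horizon - G.transit e ∧ G.exitTime f e x = θ} = {θ - τ} := by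
      ext x
      rw [mem_ofPred_eq, mem_singleton_iff, hG.transit, exitTime, hG.capacity, hG.transit]
      constructor
      · rintro ⟨hx, hxθ⟩
        have hq := div_nonneg (hG.queue_nonneg hf e hx) hG.capacity_pos.le
        have hneg : ¬ 0 ≤ x := by linarith [hmem.2]
        rw [queue, if_neg hneg] at hxθ
        rw [zero_div] at hxθ
        linarith
      · rintro rfl
        have hneg : ¬ 0 ≤ θ - τ := by linarith [hmem.2]
        rw [queue, if_neg hneg]
        constructor
        · linarith [hmem.2]
        · ring
    rw [entryTime, hset, csSup_singleton]
  rw [this]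
  intro h
  linarith [h.1, hmem.2]

include hf in
theorem integrableOn_totalOut (e : E) : IntegrableOn (f.totalOut e) (Ico 0 G.horizon) :=
  integrable_finsetSum _ fun j _ => hf.integrable_out e j

include hf in
theorem sum_cumOut (e : E) {θ : ℝ} (hθ : θ ∈ Icc 0 G.horizon) :
    ∑ j, f.cumOut e j θ = ∫ u in (0 : ℝ)..θ, f.totalOut e u :=
  (intervalIntegral.integral_finsetSum fun j _ => intervalIntegrable_of_mem_Icc
    (hf.integrable_out e j) (left_mem_Icc.2 G.horizon_pos.le) hθ).symm

include hG hf in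
theorem sum_cumOut_add (e : E) {θ : ℝ} (hθ : θ ∈ Icc 0 (G.horizon - τ)) :
    ∑ j, f.cumOut e j (θ + τ) = ∫ u in (0 : ℝ)..θ, f.totalOut e (u + τ) := by
  have hτ := hG.transit_pos
  have hτH := hG.transit_lt
  have hmem : θ + τ ∈ Icc 0 G.horizon := ⟨by linarith [hθ.1], by linarith [hθ.2]⟩
  have h0 : ∫ u in (0 : ℝ)..τ, f.totalOut e u = 0 := by
    rw [integral_congr_of_ae_Ico (H := τ) (k := fun _ => 0) _ (left_mem_Icc.2 hτ.le)
      (right_mem_Icc.2 hτ.le), intervalIntegral.integral_zero]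
    filter_upwards [eventually_countable_forall.2 fun j => hG.outflow_eq_zero hf e j] with u hu hm
    exact Finset.sum_eq_zero fun j _ => hu j hm
  have hi := integrableOn_totalOut hf e
  have h1 : (0 : ℝ) ∈ Icc 0 G.horizon := left_mem_Icc.2 G.horizon_pos.le
  have h2 : τ ∈ Icc 0 G.horizon := ⟨hτ.le, hτH.le⟩
  rw [sum_cumOut hf e hmem, ← intervalIntegral.integral_add_adjacent_intervals
    (intervalIntegrable_of_mem_Icc hi h1 h2) (intervalIntegrable_of_mem_Icc hi h2 hmem), h0,
    zero_add, intervalIntegral.integral_comp_add_right, zero_add]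

include hα hin in
omit [DecidableEq V] [Fintype E] in
theorem sum_cumIn (e : E) {θ : ℝ} (hθ : θ ∈ Icc 0 G.horizon) :
    ∑ j, f.cumIn e j θ = ∫ u in (0 : ℝ)..θ, total (α e) u := by
  unfold total
  rw [intervalIntegral.integral_finsetSum fun j _ => (hα e j).integrable.intervalIntegrable]
  exact Finset.sum_congr rfl fun j _ => integral_congr_of_ae_Ico (hin e j)
    (left_mem_Icc.2 G.horizon_pos.le) hθ

include hin in
omit [DecidableEq V] [Fintype E] in
theorem ae_totalIn (e : E) :
    ∀ᵐ θ, θ ∈ Ico 0 G.horizon → f.totalIn e θ = total (α e) θ := by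
  filter_upwards [eventually_countable_forall.2 fun j => hin e j] with θ hθ hmem
  exact Finset.sum_congr rfl fun j _ => hθ j hmem

include hG hα hf hin in
theorem isQueueOn_queue (e : E) :
    IsQueueOn (total (α e)) ν (G.horizon - τ) (G.queue f e) fun u => f.totalOut e (u + τ) := by
  have hτ := hG.transit_pos
  have hτH := hG.transit_lt
  refine ⟨fun θ hθ => ?_, fun θ hθ => ?_, fun θ hθ => hG.queue_nonneg hf e hθ.2, ?_⟩
  · have := (intervalIntegrable_of_mem_Icc (x := τ) (y := θ + τ) (integrableOn_totalOut hf e)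
      ⟨hτ.le, hτH.le⟩ ⟨by linarith [hθ.1], by linarith [hθ.2]⟩).comp_add_right τ
    rwa [sub_self, add_sub_cancel_right] at this
  · rw [queue, if_pos hθ.1, hG.transit, hG.sum_cumOut_add hf e (Ico_subset_Icc_self hθ),
      sum_cumIn hα hin e ⟨hθ.1, by linarith [hθ.2]⟩]
  · filter_upwards [hf.atCapacity e, ae_totalIn hin e] with θ h1 h2 hmem
    rw [hG.transit, hG.capacity] at h1
    rw [h1 hmem, h2 ⟨hmem.1, by linarith [hmem.2]⟩]

include hG hα hf hin in
theorem queue_eq_backlog (e : E) {x : ℝ} (hx : x < G.horizon - τ) :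
    G.queue f e x = backlog (total (α e)) ν x := by
  have ha := isRate_total (hα e)
  rcases le_or_gt 0 x with h | h
  · exact (hG.isQueueOn_queue hα hf hin e).eq_backlog ha hG.capacity_pos ⟨h, hx⟩
  · rw [queue, if_neg (not_le.2 h), ha.backlog_of_nonpos hG.capacity_pos h.le]

include hG hα hf hin in
theorem totalOut_eq_departure (e : E) :
    ∀ᵐ θ, θ ∈ Ico 0 G.horizon → f.totalOut e θ = departure (total (α e)) ν τ θ := by
  have ha := isRate_total (hα e)
  have h1 : ∀ᵐ u, u ∈ Ico 0 (G.horizon - τ) →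
      f.totalOut e (u + τ) = service (total (α e)) ν u := by
    filter_upwards [(hG.isQueueOn_queue hα hf hin e).service] with u hu hmem
    rw [hu hmem, hG.queue_eq_backlog hα hf hin e hmem.2]
    rfl
  rw [← eventually_add_right_iff volume (-τ)] at h1
  filter_upwards [h1, eventually_countable_forall.2 fun j => hG.outflow_eq_zero hf e j]
    with θ h2 h3 hmem
  rcases lt_or_ge θ τ with h | h
  · rw [ha.departure_eq_zero hG.capacity_pos h]
    exact Finset.sum_eq_zero fun j _ => h3 j ⟨hmem.1, h⟩
  · have := h2 ⟨by linarith, by linarith [hmem.2]⟩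
    rwa [neg_add_cancel_right, ← sub_eq_add_neg] at this

-- The merging rule determines each outflow from the total outflow and the inflows at the entry
-- time. The inflows agree with α only almost everywhere, and `ae_entry` carries this over to the
-- entry times of almost all departures.
include hG hα hf hin in
theorem outflow_eq (e : E) (j : P) : ∀ᵐ θ, θ ∈ Ico 0 G.horizon →
    f.outflow e j θ = (queueFlow α ν τ).outflow e j θ := by
  have ha := isRate_total (hα e)
  have hν := hG.capacity_pos
  have hP : ∀ᵐ x, 0 < total (α e) x → 0 ≤ x ∧ 0 < total (α e) x ∧
      f.totalIn e x = total (α e) x ∧ f.inflow e j x = α e j x := by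
    filter_upwards [hin e j, ae_totalIn hin e] with x h1 h2 hpos
    have hmem : x ∈ Ico 0 G.horizon := by
      by_contra h
      exact hpos.ne' (ha.eq_zero x h)
    exact ⟨hmem.1, hpos, h2 hmem, h1 hmem⟩
  filter_upwards [hf.merging e j, hG.totalOut_eq_departure hα hf hin e,
    ha.ae_entry hν hG.transit_pos hP] with θ h1 h2 h3 hmem
  rw [h1 hmem, h2 hmem, hG.entryTime_eq_entry hα (fun x hx => ?_) hmem.2]
  · change _ = share (α e j) (total (α e)) ν τ θ
    rw [share]
    rcases (ha.departure_nonneg (τ := τ) hν θ).eq_or_lt with h | h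
    · rw [← h, mul_zero, mul_zero, ite_self]
    · obtain ⟨h4, h5, h6, h7⟩ := h3 h
      rw [h6, h7, if_pos ⟨h4, h5⟩]
  · rw [exitTime, exit, hG.queue_eq_backlog hα hf hin e hx, hG.capacity, hG.transit]

end outcome

theorem ae_inflow_eq (hG : G.IsParallelNetwork s t ν τ d) {g : P → E → ℝ → ℝ}
    (hα : IsInflow G d g α) (hf : G.IsOutcome g f) (e : E) (j : P) :
    ∀ᵐ θ, θ ∈ Ico 0 G.horizon → f.inflow e j θ = α e j θ := by
  filter_upwards [hα.ae_eq e j, hf.inflow_eq j e] with θ h1 h2 hmem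
  rw [h1 hmem, h2 hmem]
  simp [hG.tail, hG.head, hG.source, hG.target, hG.source_ne, hG.source_ne.symm, hG.supply,
      mul_comm]

/-- Outcomes are unique up to null sets. -/
theorem ae_eq_of_isOutcome (hG : G.IsParallelNetwork s t ν τ d) {g : P → E → ℝ → ℝ}
    (hg : ∀ j, G.IsTemporalStrategy j (g j)) {f f' : FlowRates E P} (hf : G.IsOutcome g f)
    (hf' : G.IsOutcome g f') (e : E) (j : P) : ∀ᵐ θ, θ ∈ Ico 0 G.horizon →
      f.inflow e j θ = f'.inflow e j θ ∧ f.outflow e j θ = f'.outflow e j θ := by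
  obtain ⟨α, hα⟩ := exists_isInflow hG.supply_pos hg
  filter_upwards [hG.ae_inflow_eq hα hf e j, hG.ae_inflow_eq hα hf' e j,
    hG.outflow_eq hα.isRate hf.feasible (hG.ae_inflow_eq hα hf) e j,
    hG.outflow_eq hα.isRate hf'.feasible (hG.ae_inflow_eq hα hf') e j] with θ h1 h2 h3 h4 hmem
  exact ⟨(h1 hmem).trans (h2 hmem).symm, (h3 hmem).trans (h4 hmem).symm⟩

end IsParallelNetwork
end
end FlowGame

/-! ### Payoffs, the optimum, and the responding strategy. -/

namespace FluidQueue

open Filter Topology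

theorem integral_congr_Ico {h k : ℝ → ℝ} {x y : ℝ} (hxy : x ≤ y)
    (hhk : ∀ᵐ θ, θ ∈ Ico x y → h θ = k θ) : ∫ u in x..y, h u = ∫ u in x..y, k u := by
  rw [intervalIntegral.integral_of_le hxy, intervalIntegral.integral_of_le hxy,
    ← integral_Ico_eq_integral_Ioc, ← integral_Ico_eq_integral_Ioc]
  exact setIntegral_congr_ae measurableSet_Ico hhk

theorem integral_mono_Ico {h k : ℝ → ℝ} {x y : ℝ} (hxy : x ≤ y)
    (hh : IntervalIntegrable h volume x y) (hk : IntervalIntegrable k volume x y)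
    (hhk : ∀ᵐ θ, θ ∈ Ico x y → h θ ≤ k θ) : ∫ u in x..y, h u ≤ ∫ u in x..y, k u := by
  refine intervalIntegral.integral_mono_ae_restrict hxy hh hk ?_
  rw [Filter.EventuallyLE, ae_restrict_iff' measurableSet_Icc]
  filter_upwards [hhk, Measure.ae_ne volume y] with θ hθ hne hmem
  exact hθ ⟨hmem.1, hmem.2.lt_of_ne hne⟩

/-- If a queue never lacks work up to time `x`, then the exit time is determined by the cumulative
inflow. -/
theorem IsRate.exit_le_of_saturated {C H ν τ : ℝ} {a : ℝ → ℝ} (ha : IsRate C H a) (hν : 0 < ν)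
    {x θ : ℝ} (hsat : ∀ u ∈ Icc 0 x, ν * u ≤ ∫ v in (0 : ℝ)..u, a v)
    (hle : ∫ v in (0 : ℝ)..x, a v ≤ ν * (θ - τ)) : exit a ν τ x ≤ θ := by
  have hidle : idle a ν x ≤ 0 := IsRate.idle_le fun u hu => by
    rcases le_total 0 u with h | h
    · have := hsat u ⟨h, hu⟩
      rw [netInput]
      linarith
    · exact (ha.neg_netInput_le u).trans (mul_nonpos_of_nonneg_of_nonpos hν.le h)
  have hb : backlog a ν x ≤ ν * (θ - τ) - ν * x := by
    rw [backlog, netInput]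
    linarith
  have : backlog a ν x / ν ≤ θ - τ - x := by
    rw [div_le_iff₀ hν]
    linarith
  rw [exit]
  linarith

end FluidQueue

namespace FlowGame

open FluidQueue

section
variable {V E P : Type*} [DecidableEq V] [Fintype E] [Fintype P] {G : FlowGame V E P} {s t : V}
  {ν τ d : ℝ} {α : E → P → ℝ → ℝ} {f : FlowRates E P} {g : P → E → ℝ → ℝ}

namespace IsParallelNetwork

theorem payoff_eq (hG : G.IsParallelNetwork s t ν τ d) (hα : IsInflow G d g α)
    (hf : G.IsOutcome g f) (j : P) :
    G.payoff j f = ∑ e, ∫ x in (0 : ℝ)..entry (total (α e)) ν τ G.horizon, α e j x := by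
  simp only [payoff, hG.tail, hG.head, hG.target, hG.source_ne, Finset.filter_true,
    Finset.filter_false, Finset.sum_empty, sub_zero]
  refine Finset.sum_congr rfl fun e _ => ?_
  rw [← hG.cumOut_queueFlow hα.isRate]
  exact integral_congr_of_ae_Ico (hG.outflow_eq hα.isRate hf.feasible (hG.ae_inflow_eq hα hf) e j)
    (left_mem_Icc.2 G.horizon_pos.le) (right_mem_Icc.2 G.horizon_pos.le)

/-- What leaves an edge by time H was served in a period of length H - τ at rate at most ν. -/
theorem sum_payoff_le (hG : G.IsParallelNetwork s t ν τ d)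
    (hg : ∀ j, G.IsTemporalStrategy j (g j)) (hf : G.IsOutcome g f) :
    ∑ j, G.payoff j f ≤ Fintype.card E * (ν * (G.horizon - τ)) := by
  obtain ⟨α, hα⟩ := exists_isInflow hG.supply_pos hg
  have hν := hG.capacity_pos
  simp_rw [hG.payoff_eq hα hf]
  rw [Finset.sum_comm]
  refine (Finset.sum_le_card_nsmul _ _ (ν * (G.horizon - τ)) fun e _ => ?_).trans_eq
    (by rw [nsmul_eq_mul, Finset.card_univ])
  have ha := isRate_total (hα.isRate e)
  rw [← intervalIntegral.integral_finsetSum fun j _ =>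
    (hα.isRate e j).integrable.intervalIntegrable]
  have h1 := ha.integral_service_exit (τ := τ) hν (entry (total (α e)) ν τ G.horizon)
  rw [ha.exit_entry hν] at h1
  change ∫ x in (0 : ℝ)..entry (total (α e)) ν τ G.horizon, total (α e) x ≤ _
  rw [← h1]
  have h2 := intervalIntegral.integral_mono_on (μ := volume) (sub_nonneg.2 hG.transit_lt.le)
    (ha.intervalIntegrable_service hν 0 _) (intervalIntegrable_const (c := ν))
    fun u _ => service_le (a := total (α e)) u
  simpa [mul_comm] using h2

-- Constant inflow ν into every edge attains the bound, and the assumption on D makes it admissible.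
omit [Fintype P] in
theorem isMaxFlowOverTimeValue (hG : G.IsParallelNetwork s t ν τ d) {D : ℝ}
    (hD : Fintype.card E * ν ≤ D) :
    G.IsMaxFlowOverTimeValue s t D (Fintype.card E * (ν * (G.horizon - τ))) := by
  have hν := hG.capacity_pos
  have hτ := hG.transit_pos
  have hτH := hG.transit_lt
  have hval : ∀ x, G.classicalValue t x = ∑ e, ∫ θ in (0 : ℝ)..G.horizon, G.arrival x e θ :=
    fun x => by simp [classicalValue, hG.tail, hG.head, hG.source_ne]
  have harr : ∀ x e, (∀ θ ∈ Ico 0 G.horizon, x e θ ∈ Icc 0 (G.capacity e)) →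
      IntegrableOn (x e) (Ico 0 G.horizon) →
      ∫ θ in (0 : ℝ)..G.horizon, G.arrival x e θ = ∫ θ in (0 : ℝ)..G.horizon - τ, x e θ := by
    intro x e hx hi
    have h0 : ∀ θ ∈ Ico 0 τ, (0 : ℝ) = G.arrival x e θ := fun θ hθ => by
      rw [arrival, hG.transit, if_neg (not_le.2 hθ.2)]
    have h1 : ∀ θ ∈ Ico τ G.horizon, x e (θ - τ) = G.arrival x e θ := fun θ hθ => by
      rw [arrival, hG.transit, if_pos hθ.1]
    have hi1 : IntervalIntegrable (fun θ => x e (θ - τ)) volume τ G.horizon := by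
      have := (intervalIntegrable_of_mem_Icc hi (left_mem_Icc.2 G.horizon_pos.le)
        (y := G.horizon - τ) ⟨by linarith, by linarith⟩).comp_sub_right τ
      rwa [zero_add, sub_add_cancel] at this
    have hi2 : IntervalIntegrable (G.arrival x e) volume τ G.horizon := by
      rw [intervalIntegrable_iff_integrableOn_Ico_of_le hτH.le] at hi1 ⊢
      exact hi1.congr_fun h1 measurableSet_Ico
    have hi3 : IntervalIntegrable (G.arrival x e) volume 0 τ := by
      rw [intervalIntegrable_iff_integrableOn_Ico_of_le hτ.le]
      exact integrableOn_zero.congr_fun h0 measurableSet_Ico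
    rw [← intervalIntegral.integral_add_adjacent_intervals hi3 hi2,
      ← integral_congr_Ico hτ.le (Filter.Eventually.of_forall h0),
      ← integral_congr_Ico hτH.le (Filter.Eventually.of_forall h1),
      intervalIntegral.integral_zero, zero_add,
      intervalIntegral.integral_comp_sub_right, sub_self]
  constructor
  · refine ⟨fun _ _ => ν, ⟨fun e => integrableOn_const (by simp), fun e θ _ => ?_,
      fun v h1 h2 => absurd (hG.eq_or_eq v) (by tauto), ?_⟩, ?_⟩
    · rw [hG.capacity]
      exact ⟨hν.le, le_rfl⟩
    · refine Filter.Eventually.of_forall fun θ _ => ?_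
      simpa [hG.tail, hG.head, hG.source_ne.symm] using hD
    · rw [hval, Finset.sum_congr rfl fun e _ => harr _ e (fun θ _ => ?_)
        (integrableOn_const (by simp))]
      · simp [mul_comm]
      · rw [hG.capacity]
        exact ⟨hν.le, le_rfl⟩
  · rintro _ ⟨x, hx, rfl⟩
    rw [hval]
    refine (Finset.sum_le_card_nsmul _ _ (ν * (G.horizon - τ)) fun e _ => ?_).trans_eq
      (by rw [nsmul_eq_mul, Finset.card_univ])
    rw [harr x e (hx.capacity e) (hx.integrable e)]
    have h2 := integral_mono_Ico (k := fun _ => ν) (sub_nonneg.2 hτH.le)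
      (intervalIntegrable_of_mem_Icc (hx.integrable e) (left_mem_Icc.2 G.horizon_pos.le)
        (y := G.horizon - τ) ⟨by linarith, by linarith⟩) intervalIntegrable_const
      (Filter.Eventually.of_forall fun θ hθ =>
        ((hx.capacity e θ ⟨hθ.1, by linarith [hθ.2]⟩).2.trans_eq (hG.capacity e)))
    simpa [mul_comm] using h2

omit [DecidableEq V] [Fintype E] in
theorem integral_le_of_exit_le (hG : G.IsParallelNetwork s t ν τ d)
    (hα : ∀ e j, IsRate d G.horizon (α e j)) (e : E) (j : P) {x θ : ℝ}
    (h : exit (total (α e)) ν τ x ≤ θ) :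
    ∫ u in (0 : ℝ)..x, α e j u ≤ ∫ u in (0 : ℝ)..entry (total (α e)) ν τ θ, α e j u :=
  (hα e j).integral_mono (((isRate_total (hα e)).exit_le_iff hG.capacity_pos).1 h)

end IsParallelNetwork

/-- The response to an opponent who sends the proportions `o e₁` and `o e₂` into two edges: up to
time `x` mirror the opponent, but send as much as possible into `e₁` subject to an inflow of at
least the capacity into `e₂`, and from then on send everything into `e₂`. Here `c` is one minus the
quotient of capacity and supply. -/
noncomputable def response [DecidableEq E] (o : E → ℝ → ℝ) (e₁ e₂ : E) (c x : ℝ) (e : E) (θ : ℝ) :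
    ℝ :=
  if e = e₁ then if θ < x then o e₂ θ + min (o e₁ θ) c else 0
  else if θ < x then o e₁ θ - min (o e₁ θ) c else 1

omit [Fintype P] in
theorem isTemporalStrategy_response [DecidableEq E] (hG : G.IsParallelNetwork s t ν τ d)
    {k : P} {o : E → ℝ → ℝ} (ho : G.IsTemporalStrategy k o) {e₁ e₂ : E} (hne : e₁ ≠ e₂)
    (huniv : (Finset.univ : Finset E) = {e₁, e₂}) {c : ℝ} (hc : 0 ≤ c) (x : ℝ) (j : P) :
    G.IsTemporalStrategy j (response o e₁ e₂ c x) := by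
  have hsum : ∀ θ ∈ Ico 0 G.horizon, o e₁ θ + o e₂ θ = 1 := fun θ hθ => by
    have := ho.sum_eq_one s (by rw [hG.target]; exact hG.source_ne) θ hθ
    simp only [hG.tail, Finset.filter_true] at this
    rwa [huniv, Finset.sum_pair hne] at this
  have hmin : IntegrableOn (fun θ => min (o e₁ θ) c) (Ico 0 G.horizon) :=
    (ho.integrable e₁).inf (integrableOn_const (by simp))
  have hite : ∀ {u v : ℝ → ℝ}, IntegrableOn u (Ico 0 G.horizon) →
      IntegrableOn v (Ico 0 G.horizon) →
      IntegrableOn (fun θ => if θ < x then u θ else v θ) (Ico 0 G.horizon) :=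
    fun hu hv => by
      classical
      exact Integrable.piecewise (s := Iio x) measurableSet_Iio hu.integrableOn hv.integrableOn
  refine ⟨fun e => ?_, fun e θ hθ => ?_, fun v hv θ hθ => ?_⟩
  · by_cases he : e = e₁
    · have : response o e₁ e₂ c x e
          = fun θ => if θ < x then o e₂ θ + min (o e₁ θ) c else 0 :=
        funext fun θ => if_pos he
      rw [this]
      exact hite ((ho.integrable e₂).add hmin) integrableOn_zero
    · have : response o e₁ e₂ c x e
          = fun θ => if θ < x then o e₁ θ - min (o e₁ θ) c else 1 :=
        funext fun θ => if_neg he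
      rw [this]
      exact hite ((ho.integrable e₁).sub hmin) (integrableOn_const (by simp))
  · have h1 := ho.mem_unit e₁ θ hθ
    have h2 := ho.mem_unit e₂ θ hθ
    have h3 := hsum θ hθ
    have h4 := min_le_left (o e₁ θ) c
    have h5 : 0 ≤ min (o e₁ θ) c := le_min h1.1 hc
    rw [response]
    split_ifs <;> constructor <;> linarith [h1.1, h1.2, h2.1, h2.2]
  · have hvs : v = s := (hG.eq_or_eq v).resolve_right (hG.target j ▸ hv)
    subst hvs
    simp only [hG.tail, Finset.filter_true]
    rw [huniv, Finset.sum_pair hne, response, response, if_pos rfl, if_neg hne.symm]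
    split_ifs
    · linarith [hsum θ hθ]
    · norm_num

end
end FlowGame

/-! ### The response beats half of the optimum. -/

namespace FlowGame

open FluidQueue

section
variable {V E P : Type*} [DecidableEq V] [Fintype E] [Fintype P] {G : FlowGame V E P} {s t : V}
  {ν τ d : ℝ}

theorem isRate_min {β : ℝ → ℝ} {H c : ℝ} (hβ : IsRate d H β) (hc : 0 ≤ c) :
    IsRate d H fun θ => min (β θ) c where
  measurable := hβ.measurable.min measurable_const
  nonneg θ := le_min (hβ.nonneg θ) hc
  le_bound θ := (min_le_left _ _).trans (hβ.le_bound θ)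
  eq_zero θ hθ := by rw [hβ.eq_zero θ hθ, min_eq_left hc]

/-- If the supply is split between two rates, then one of them is positive right before
time `T`. -/
theorem forall_integral_min_pos_or {β₁ β₂ : ℝ → ℝ} {H T c : ℝ} (h₁ : IsRate d H β₁)
    (h₂ : IsRate d H β₂) (hc : 0 < c) (hcd : c ≤ d) (hT : T ≤ H)
    (hsum : ∀ᵐ θ, θ ∈ Ico 0 H → β₁ θ + β₂ θ = d) :
    (∀ u ∈ Ico 0 T, 0 < ∫ θ in u..T, min (β₁ θ) c) ∨
      ∀ u ∈ Ico 0 T, 0 < ∫ θ in u..T, min (β₂ θ) c := by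
  by_contra! h
  obtain ⟨⟨u, hu, hu'⟩, v, hv, hv'⟩ := h
  have hw₁ := isRate_min h₁ hc.le
  have hw₂ := isRate_min h₂ hc.le
  have hle : ∀ {w : ℝ → ℝ}, IsRate d H w → ∀ x ≤ max u v,
      ∫ θ in max u v..T, w θ ≤ ∫ θ in x..T, w θ := by
    intro w hw x hx
    rw [← hw.integral_sub (max u v) T, ← hw.integral_sub x T]
    exact sub_le_sub_left (hw.integral_mono hx) _
  have hlt : max u v < T := max_lt hu.2 hv.2
  have h0 : 0 ≤ max u v := hu.1.trans (le_max_left _ _)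
  -- The rates sum to d ≥ c, so the two truncated rates sum to at least c; their integrals over a
  -- common final interval cannot both be nonpositive.
  have h3 : ∫ θ in max u v..T, c ≤ ∫ θ in max u v..T, (min (β₁ θ) c + min (β₂ θ) c) := by
    refine integral_mono_Ico hlt.le intervalIntegrable_const
      (hw₁.integrable.intervalIntegrable.add hw₂.integrable.intervalIntegrable) ?_
    filter_upwards [hsum] with θ hθ hmem
    have h4 := hθ ⟨h0.trans hmem.1, hmem.2.trans_le hT⟩
    have h5 := h₁.nonneg θ
    have h6 := h₂.nonneg θ
    rcases min_cases (β₁ θ) c with h | h <;> rcases min_cases (β₂ θ) c with h' | h' <;> linarith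
  rw [intervalIntegral.integral_const, smul_eq_mul, intervalIntegral.integral_add
    hw₁.integrable.intervalIntegrable hw₂.integrable.intervalIntegrable] at h3
  have h4 := hle hw₁ u (le_max_left _ _)
  have h5 := hle hw₂ v (le_max_right _ _)
  have h6 := mul_pos (sub_pos.2 hlt) hc
  linarith

omit [DecidableEq V] [Fintype E] in
/-- If from time `x` on the opponent still sends flow into an edge that has by then received all the
flow that can leave it in time, and the player sends everything into the other edge, then the player
gets more than half of the maximum. -/
theorem lt_sum_of_saturated (hG : G.IsParallelNetwork s t ν τ d) {α : E → P → ℝ → ℝ}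
    (hα : ∀ e j, IsRate d G.horizon (α e j)) (hνd : ν < d) {e₁ e₂ : E} {j : P} {β : ℝ → ℝ}
    (hβ : IsRate d G.horizon β) {x : ℝ} (hx0 : 0 ≤ x) (hx : d * x < ν * (G.horizon - τ))
    (hfill : d * x + (∫ θ in (0 : ℝ)..x, min (β θ) (d - ν)) = ν * (G.horizon - τ))
    (hpos : 0 < ∫ θ in x..ν * (G.horizon - τ) / d, β θ)
    (h₁ : ∀ᵐ θ, θ ∈ Ico 0 G.horizon →
      total (α e₁) θ = if θ < x then d + min (β θ) (d - ν) else β θ)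
    (h₁₂ : ∀ᵐ θ, θ ∈ Ico 0 G.horizon → total (α e₁) θ + total (α e₂) θ = 2 * d)
    (hj : ∀ᵐ θ, θ ∈ Ico 0 G.horizon → α e₁ j θ + α e₂ j θ = d)
    (hj₂ : ∀ᵐ θ, θ ∈ Ico x G.horizon → α e₂ j θ = d) :
    ν * (G.horizon - τ) < (∫ u in (0 : ℝ)..entry (total (α e₁)) ν τ G.horizon, α e₁ j u)
      + ∫ u in (0 : ℝ)..entry (total (α e₂)) ν τ G.horizon, α e₂ j u := by
  have hν := hG.capacity_pos
  have hτ := hG.transit_pos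
  have hd := hG.supply_pos
  have ha₁ := isRate_total (hα e₁)
  have ha₂ := isRate_total (hα e₂)
  have hw := isRate_min hβ (sub_nonneg.2 hνd.le)
  set K := ν * (G.horizon - τ) with hK
  set T := K / d with hT
  have hdT : d * T = K := mul_div_cancel₀ K hd.ne'
  have hxT : x < T := by rwa [hT, lt_div_iff₀' hd]
  have hTH : T < G.horizon - τ := by
    rw [hT, div_lt_iff₀ hd, hK, mul_comm]
    exact mul_lt_mul_of_pos_left hνd (sub_pos.2 hG.transit_lt)
  -- cumulative inflows at the times `x` and `T`
  have hA₁x : ∫ θ in (0 : ℝ)..x, total (α e₁) θ = K := by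
    rw [integral_congr_Ico (k := fun θ => d + min (β θ) (d - ν)) hx0,
      intervalIntegral.integral_add intervalIntegrable_const hw.integrable.intervalIntegrable,
      intervalIntegral.integral_const, smul_eq_mul, sub_zero, mul_comm, hfill]
    filter_upwards [h₁] with θ hθ hmem
    rw [hθ ⟨hmem.1, by linarith [hmem.2]⟩, if_pos hmem.2]
  -- Between x and T the first edge receives just the opponent's flow β, which arrives too late.
  have hA₁T : K < ∫ θ in (0 : ℝ)..T, total (α e₁) θ := by
    rw [← hA₁x, ← sub_pos, ha₁.integral_sub]
    rwa [integral_congr_Ico (k := β) hxT.le]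
    filter_upwards [h₁] with θ hθ hmem
    rw [hθ ⟨hx0.trans hmem.1, by linarith [hmem.2]⟩, if_neg (not_lt.2 hmem.1)]
  -- The total supply up to T is 2K, and the first edge has taken more than K of it.
  have hA₂T : ∫ θ in (0 : ℝ)..T, total (α e₂) θ < K := by
    have h : ∫ θ in (0 : ℝ)..T, (total (α e₁) θ + total (α e₂) θ) = ∫ θ in (0 : ℝ)..T, 2 * d := by
      refine integral_congr_Ico (hx0.trans hxT.le) ?_
      filter_upwards [h₁₂] with θ hθ hmem
      exact hθ ⟨hmem.1, by linarith [hmem.2]⟩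
    rw [intervalIntegral.integral_add ha₁.integrable.intervalIntegrable
      ha₂.integrable.intervalIntegrable, intervalIntegral.integral_const, smul_eq_mul] at h
    linarith
  -- a later time up to which the inflow into the second edge leaves in time
  obtain ⟨y, ⟨hyT, hyH⟩, hA₂y⟩ : ∃ y ∈ Ioo T (G.horizon - τ),
      ∫ θ in (0 : ℝ)..y, total (α e₂) θ < K :=
    (Filter.Eventually.and (Ioo_mem_nhdsGT hTH) (((ha₂.continuous_integral.tendsto T).eventually
      (gt_mem_nhds hA₂T)).filter_mono nhdsWithin_le_nhds)).exists
  have hsat : ∀ {e : E} {z c : ℝ}, ν ≤ c →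
      (∀ᵐ θ, θ ∈ Ico 0 z → c ≤ total (α e) θ) →
      ∀ u ∈ Icc 0 z, ν * u ≤ ∫ v in (0 : ℝ)..u, total (α e) v := by
    intro e z c hc h u hu
    have h' : ∫ v in (0 : ℝ)..u, ν ≤ ∫ v in (0 : ℝ)..u, total (α e) v := by
      refine integral_mono_Ico hu.1 intervalIntegrable_const
        (isRate_total (hα e)).integrable.intervalIntegrable ?_
      filter_upwards [h] with θ hθ hmem
      exact hc.trans (hθ ⟨hmem.1, hmem.2.trans_le hu.2⟩)
    rwa [intervalIntegral.integral_const, smul_eq_mul, sub_zero, mul_comm] at h'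
  have hexit₁ : exit (total (α e₁)) ν τ x ≤ G.horizon := by
    refine ha₁.exit_le_of_saturated hν (hsat hνd.le ?_) hA₁x.le
    filter_upwards [h₁] with θ hθ hmem
    rw [hθ ⟨hmem.1, by linarith [hmem.2]⟩, if_pos hmem.2]
    exact le_add_of_nonneg_right (hw.nonneg θ)
  -- The inflow into the second edge is d - min(β, d - ν) ≥ ν before x and 2d - β ≥ d afterwards.
  -- The truncation at d - ν is chosen for this bound.
  have hexit₂ : exit (total (α e₂)) ν τ y ≤ G.horizon := by
    refine ha₂.exit_le_of_saturated hν (hsat le_rfl ?_) hA₂y.le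
    filter_upwards [h₁, h₁₂] with θ hθ hθ' hmem
    have h := hθ ⟨hmem.1, by linarith [hmem.2]⟩
    have h' := hθ' ⟨hmem.1, by linarith [hmem.2]⟩
    have h2 := min_le_right (β θ) (d - ν)
    have h3 := hβ.le_bound θ
    split_ifs at h <;> linarith
  have hp₁ := hG.integral_le_of_exit_le hα e₁ j hexit₁
  have hp₂ := hG.integral_le_of_exit_le hα e₂ j hexit₂
  have hxy : x ≤ y := hxT.le.trans hyT.le
  have hq₁ : (∫ u in (0 : ℝ)..x, α e₁ j u) + ∫ u in (0 : ℝ)..x, α e₂ j u = d * x := by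
    rw [← intervalIntegral.integral_add (hα e₁ j).integrable.intervalIntegrable
      (hα e₂ j).integrable.intervalIntegrable, integral_congr_Ico (k := fun _ => d) hx0,
      intervalIntegral.integral_const, smul_eq_mul, sub_zero, mul_comm]
    filter_upwards [hj] with θ hθ hmem
    exact hθ ⟨hmem.1, by linarith [hmem.2]⟩
  have hq₂ : ∫ u in x..y, α e₂ j u = d * (y - x) := by
    rw [integral_congr_Ico (k := fun _ => d) hxy, intervalIntegral.integral_const, smul_eq_mul,
      mul_comm]
    filter_upwards [hj₂] with θ hθ hmem
    exact hθ ⟨hmem.1, by linarith [hmem.2]⟩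
  have hq₃ := (hα e₂ j).integral_sub x y
  have hdy : d * T < d * y := mul_lt_mul_of_pos_left hyT hd
  -- All of the player's supply up to y arrives: d x up to time x on both edges, then d (y - x) on
  -- the second, in total d y > d T = K.
  linarith

theorem exists_response [DecidableEq P] (hG : G.IsParallelNetwork s t ν τ d) (hνd : ν < d)
    (hE : Fintype.card E = 2) (hP : Fintype.card P = 2) {g : P → E → ℝ → ℝ}
    (hg : ∀ j, G.IsTemporalStrategy j (g j)) (j : P) :
    ∃ h, G.IsTemporalStrategy j h ∧ ∀ f, G.IsOutcome (Function.update g j h) f →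
      ν * (G.horizon - τ) < G.payoff j f := by
  classical
  have hν := hG.capacity_pos
  have hd := hG.supply_pos
  have hc : 0 < d - ν := sub_pos.2 hνd
  have hL : 0 < G.horizon - τ := sub_pos.2 hG.transit_lt
  obtain ⟨k, hkj⟩ := Fintype.exists_ne_of_one_lt_card (by omega) j
  have hPuniv : (Finset.univ : Finset P) = {j, k} :=
    ((Finset.card_eq_iff_eq_univ _).1 (by rw [Finset.card_pair hkj.symm, hP])).symm
  obtain ⟨β, hβ⟩ := exists_isInflow hd hg
  set K := ν * (G.horizon - τ) with hK
  have hKpos : 0 < K := mul_pos hν hL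
  set T := K / d with hT
  have hdT : d * T = K := mul_div_cancel₀ K hd.ne'
  have hT0 : 0 < T := div_pos hKpos hd
  have hTH : T < G.horizon - τ := by
    rw [hT, div_lt_iff₀ hd, hK, mul_comm]
    exact mul_lt_mul_of_pos_left hνd hL
  have hopp : ∀ e₁ e₂ : E, e₁ ≠ e₂ → (Finset.univ : Finset E) = {e₁, e₂} ∧
      ∀ θ ∈ Ico 0 G.horizon, g k e₁ θ + g k e₂ θ = 1 := by
    intro e₁ e₂ hne
    have huniv : (Finset.univ : Finset E) = {e₁, e₂} :=
      ((Finset.card_eq_iff_eq_univ _).1 (by rw [Finset.card_pair hne, hE])).symm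
    refine ⟨huniv, fun θ hθ => ?_⟩
    have := (hg k).sum_eq_one s (by rw [hG.target]; exact hG.source_ne) θ hθ
    simp only [hG.tail, Finset.filter_true] at this
    rwa [huniv, Finset.sum_pair hne] at this
  -- The edge to be overfilled is one that the opponent uses on every final interval before T, so
  -- she still sends flow into it after x, wherever x < T lies.
  obtain ⟨e₁, e₂, hne, hlate⟩ : ∃ e₁ e₂ : E, e₁ ≠ e₂ ∧
      ∀ u ∈ Ico 0 T, 0 < ∫ θ in u..T, min (β e₁ k θ) (d - ν) := by
    obtain ⟨e₁, e₂, hne⟩ := Fintype.exists_pair_of_one_lt_card (α := E) (by omega)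
    rcases forall_integral_min_pos_or (hβ.isRate e₁ k) (hβ.isRate e₂ k) hc (by linarith)
      (T := T) (by linarith [hG.transit_pos]) (by
        filter_upwards [hβ.ae_eq e₁ k, hβ.ae_eq e₂ k] with θ h1 h2 hmem
        rw [h1 hmem, h2 hmem, ← mul_add, (hopp e₁ e₂ hne).2 θ hmem, mul_one]) with h | h
    · exact ⟨e₁, e₂, hne, h⟩
    · exact ⟨e₂, e₁, hne.symm, h⟩
  obtain ⟨huniv, hsum⟩ := hopp e₁ e₂ hne
  have hw := isRate_min (hβ.isRate e₁ k) hc.le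
  -- x is the time at which the first edge has received K under the mirroring strategy. At T the
  -- inflow would exceed K, so the intermediate value theorem applies and x < T.
  obtain ⟨x, hx, hfill⟩ : ∃ x ∈ Icc 0 T,
      d * x + (∫ θ in (0 : ℝ)..x, min (β e₁ k θ) (d - ν)) = K := by
    refine intermediate_value_Icc hT0.le (f := fun x =>
      d * x + ∫ θ in (0 : ℝ)..x, min (β e₁ k θ) (d - ν))
      ((continuous_const.mul continuous_id).add hw.continuous_integral).continuousOn ⟨?_, ?_⟩
    · simpa using hKpos.le
    · have := hlate 0 ⟨le_rfl, hT0⟩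
      linarith
  have hxT : x < T := by
    refine hx.2.lt_of_ne fun h => ?_
    have := hlate 0 ⟨le_rfl, hT0⟩
    rw [h] at hfill
    linarith
  have hstrat := isTemporalStrategy_response hG (hg k) hne huniv (c := (d - ν) / d)
    (div_nonneg hc.le hd.le) x j
  refine ⟨_, hstrat, fun f hf => ?_⟩
  have hg' : ∀ i, G.IsTemporalStrategy i
      (Function.update g j (response (g k) e₁ e₂ ((d - ν) / d) x) i) := fun i => by
    rcases eq_or_ne i j with rfl | hij
    · rwa [Function.update_self]
    · rw [Function.update_of_ne hij]
      exact hg i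
  obtain ⟨α, hα⟩ := exists_isInflow hd hg'
  have hmin : ∀ θ, d * min (g k e₁ θ) ((d - ν) / d) = min (d * g k e₁ θ) (d - ν) := fun θ => by
    rw [mul_min_of_nonneg _ _ hd.le, mul_div_cancel₀ _ hd.ne']
  have htotal : ∀ e θ, total (α e) θ = α e j θ + α e k θ := fun e θ => by
    rw [total, hPuniv, Finset.sum_pair hkj.symm]
  -- β represents the original profile and α the modified one; they agree on the opponent k, whose
  -- strategy is unchanged.
  have hall : ∀ᵐ θ, θ ∈ Ico 0 G.horizon →
      (α e₁ j θ = if θ < x then d * g k e₂ θ + min (β e₁ k θ) (d - ν) else 0) ∧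
      (α e₂ j θ = if θ < x then β e₁ k θ - min (β e₁ k θ) (d - ν) else d) ∧
      α e₁ k θ = β e₁ k θ ∧ α e₂ k θ = d * g k e₂ θ ∧ β e₁ k θ + d * g k e₂ θ = d := by
    filter_upwards [hα.ae_eq e₁ j, hα.ae_eq e₂ j, hα.ae_eq e₁ k, hα.ae_eq e₂ k, hβ.ae_eq e₁ k]
      with θ h1 h2 h3 h4 h5 hmem
    rw [h1 hmem, h2 hmem, h3 hmem, h4 hmem, h5 hmem, Function.update_self,
      Function.update_of_ne hkj, response, response, if_pos rfl, if_neg hne.symm, ← hmin]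
    refine ⟨?_, ?_, rfl, rfl, by rw [← mul_add, hsum θ hmem, mul_one]⟩ <;> split_ifs <;> ring
  rw [hG.payoff_eq hα hf, huniv, Finset.sum_pair hne]
  refine lt_sum_of_saturated hG hα.isRate hνd (hβ.isRate e₁ k) hx.1
    ((mul_lt_mul_of_pos_left hxT hd).trans_eq hdT) hfill ?_ ?_ ?_ ?_ ?_
  · refine (hlate x ⟨hx.1, hxT⟩).trans_le (integral_mono_Ico hxT.le
      hw.integrable.intervalIntegrable (hβ.isRate e₁ k).integrable.intervalIntegrable
      (Filter.Eventually.of_forall fun θ _ => min_le_left _ _))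
  · filter_upwards [hall] with θ hθ hmem
    obtain ⟨h1, h2, h3, h4, h5⟩ := hθ hmem
    rw [htotal, h1, h3]
    split_ifs <;> linarith
  · filter_upwards [hall] with θ hθ hmem
    obtain ⟨h1, h2, h3, h4, h5⟩ := hθ hmem
    rw [htotal, htotal, h1, h2, h3, h4]
    split_ifs <;> linarith
  · filter_upwards [hall] with θ hθ hmem
    obtain ⟨h1, h2, h3, h4, h5⟩ := hθ hmem
    rw [h1, h2]
    split_ifs <;> linarith
  · filter_upwards [hall] with θ hθ hmem
    rw [(hθ ⟨hx.1.trans hmem.1, hmem.2⟩).2.1, if_neg (not_lt.2 hmem.1)]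

end
end FlowGame

theorem theorem1 {V E P : Type*} [Fintype V] [DecidableEq V] [Fintype E] [Fintype P]
    [DecidableEq P] (G : FlowGame V E P) (s t : V) (ν τ d : ℝ)
    (hV : Fintype.card V = 2) (hE : Fintype.card E = 2) (hP : Fintype.card P = 2)
    (hedge : ∀ e, G.tail e = s ∧ G.head e = t)
    (hplayer : ∀ j, G.source j = s ∧ G.target j = t)
    (hcap : ∀ e, G.capacity e = ν) (htransit : ∀ e, G.transit e = τ)
    (hsupply : ∀ j, G.supply j = d) (hνd : ν < d) (hτH : τ < G.horizon) :
    -- every strategy profile results in a feasible flow over time, unique up to null sets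
    (∀ g : P → E → ℝ → ℝ, (∀ j, G.IsTemporalStrategy j (g j)) →
      (∃ f, G.IsOutcome g f) ∧
      ∀ f f', G.IsOutcome g f → G.IsOutcome g f' → ∀ e j, ∀ᵐ θ, θ ∈ Set.Ico 0 G.horizon →
        f.inflow e j θ = f'.inflow e j θ ∧ f.outflow e j θ = f'.outflow e j θ) ∧
    -- against every strategy of the opponent, a player can get more than half of the optimum
    (∃ opt : ℝ, G.IsMaxFlowOverTimeValue s t (∑ j, G.supply j) opt ∧
      ∀ g : P → E → ℝ → ℝ, (∀ j, G.IsTemporalStrategy j (g j)) →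
        ∀ j, ∃ h, G.IsTemporalStrategy j h ∧
          ∀ f, G.IsOutcome (Function.update g j h) f → opt / 2 < G.payoff j f) ∧
    -- there is no pure Nash equilibrium
    ¬ ∃ g : P → E → ℝ → ℝ, G.IsNashEquilibrium g := by
  obtain ⟨e₀⟩ : Nonempty E := Fintype.card_pos_iff.1 (by omega)
  obtain ⟨j₀⟩ : Nonempty P := Fintype.card_pos_iff.1 (by omega)
  have hst : s ≠ t := by
    have := G.source_ne_target j₀
    rwa [(hplayer j₀).1, (hplayer j₀).2] at this
  have hVuniv : (Finset.univ : Finset V) = {s, t} :=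
    ((Finset.card_eq_iff_eq_univ _).1 (by rw [Finset.card_pair hst, hV])).symm
  have hG : G.IsParallelNetwork s t ν τ d :=
    { source_ne := hst
      eq_or_eq := fun v => by simpa [hVuniv] using Finset.mem_univ v
      tail := fun e => (hedge e).1
      head := fun e => (hedge e).2
      source := fun j => (hplayer j).1
      target := fun j => (hplayer j).2
      capacity := hcap
      transit := htransit
      supply := hsupply
      capacity_pos := hcap e₀ ▸ G.capacity_pos e₀
      transit_pos := htransit e₀ ▸ G.transit_pos e₀
      supply_pos := hsupply j₀ ▸ G.supply_pos j₀
      transit_lt := hτH }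
  have hexists : ∀ g : P → E → ℝ → ℝ, (∀ j, G.IsTemporalStrategy j (g j)) →
      ∃ f, G.IsOutcome g f := fun g hg => by
    obtain ⟨α, hα⟩ := FlowGame.exists_isInflow hG.supply_pos hg
    exact ⟨_, hG.isOutcome_queueFlow hg hα⟩
  have hhalf : Fintype.card E * (ν * (G.horizon - τ)) / 2 = ν * (G.horizon - τ) := by
    rw [hE, Nat.cast_ofNat]
    ring
  refine ⟨fun g hg => ⟨hexists g hg, fun f f' hf hf' e j => hG.ae_eq_of_isOutcome hg hf hf' e j⟩,
    ⟨Fintype.card E * (ν * (G.horizon - τ)), hG.isMaxFlowOverTimeValue ?_, fun g hg j => ?_⟩, ?_⟩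
  · simp_rw [hsupply]
    rw [Finset.sum_const, Finset.card_univ, nsmul_eq_mul, hE, hP]
    exact mul_le_mul_of_nonneg_left hνd.le (Nat.cast_nonneg 2)
  · rw [hhalf]
    exact FlowGame.exists_response hG hνd hE hP hg j
  · rintro ⟨g, hg, hnash⟩
    obtain ⟨f, hf⟩ := hexists g hg
    -- In an equilibrium no response pays more than the current payoff, so both payoffs exceed K
    -- although they sum to at most 2K.
    have hlt : ∀ j, ν * (G.horizon - τ) < G.payoff j f := fun j => by
      obtain ⟨h, hh, hbetter⟩ := FlowGame.exists_response hG hνd hE hP hg j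
      obtain ⟨f', hf'⟩ := hexists (Function.update g j h) fun i => by
        rcases eq_or_ne i j with rfl | hij
        · rwa [Function.update_self]
        · rw [Function.update_of_ne hij]
          exact hg i
      exact (hbetter f' hf').trans_le (hnash j h hh f f' hf hf')
    have h1 := hG.sum_payoff_le hg hf
    have h2 := Finset.sum_lt_sum_of_nonempty (Finset.univ_nonempty_iff.2 ⟨j₀⟩)
      fun j (_ : j ∈ Finset.univ) => hlt j
    rw [Finset.sum_const, Finset.card_univ, nsmul_eq_mul, hP] at h2
    rw [hE] at h1
    exact absurd h1 (not_le.2 h2)
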